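/- Identify $\mathbb R^4=\mathbb C^2$ by $z_1=x^1+ix^2$, $z_2=x^3+ix^4$, and let $\omega_0=dx^1\wedge dx^2+dx^3\wedge dx^4$ and let $\triangledown$ be the flat derivative. Let $(M^4,g,J)$ be an ALE Kähler surface with $g$ of class $C^2$: a complete connected non-compact Kähler manifold of complex dimension $2$ with a compact set $K$ such that $M-K$ has finitely many components (the ends), each of which is diffeomorphic to a quotient $(\mathbb R^4-\mathbf D)/\Gamma'$, where $\mathbf D$ is a closed ball about $0$ and $\Gamma'\subset \mathbf O(4)$ is a finite group acting freely on the unit sphere, in such a way that $g_{jk}=\delta_{jk}+O(|x|^{-1-\varepsilon'})$ and $g_{jk,\ell}=O(|x|^{-2-\varepsilon'})$ for some $\varepsilon'>0$. Let $M_{\infty,i}$ be an end of $M$, let $\widetilde M_{\infty,i}$ be its universal cover, and let $(x^1,\dots,x^4):\widetilde M_{\infty,i}\to\mathbb R^4-B$ be a diffeomorphism, where $B$ is a closed ball of positive radius centered at the origin. Suppose that the deck transformations of $\widetilde M_{\infty,i}\to M_{\infty,i}$ are represented in these coordinates by the action of a finite group $\Gamma_i\subset\mathbf U(2)$ acting on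 $\mathbb R^4=\mathbb C^2$ in the usual way, and that in these coordinates the Kähler form $\omega=g(J\cdot,\cdot)$ is $C^2$ and satisfies, for some $\varepsilon>0$, $$\omega=\omega_0+O(|x|^{-1-\varepsilon}),\qquad \triangledown\omega=O(|x|^{-2-\varepsilon})\qquad (|x|\to\infty).$$ Then there are a closed ball $C\subset\mathbb R^4$ centered at the origin, a closed $C^2$ $4$-ball $D\subset\mathbb R^4$ (the image of the standard closed ball under a $C^2$ diffeomorphism of $\mathbb R^4$, so that $\partial D$ is a $C^2$ embedded $S^3$) with $\Gamma_i$-invariant boundary $\partial D$ and with $B\subset C\cap D$, and a $\Gamma_i$-equivariant $C^2$ diffeomorphism $\Phi:\mathbb R^4-C\to\mathbb R^4-D$ such that $$\Phi^*\omega=\omega_0,\qquad |\Phi(x)-x|=O(|x|^{-\varepsilon}),\qquad |\Phi_*-I|=O(|x|^{-1-\varepsilon})\qquad (|x|\to\infty).$$ -/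

import Mathlib

open Set Filter Topology Asymptotics Manifold Bundle
open scoped ContDiff

noncomputable section

/-! ### The model space `ℝ⁴ = ℂ²` -/

/-- `ℝ⁴` with its Euclidean norm; the coordinates `x¹, x², x³, x⁴` have indices `0, 1, 2, 3`, and
`z₁ = x¹ + i x²`, `z₂ = x³ + i x⁴` identify it with `ℂ²`. -/
abbrev R4 : Type := EuclideanSpace ℝ (Fin 4)

/-- The standard complex structure
`J₀ = dx¹ ⊗ ∂₂ - dx² ⊗ ∂₁ + dx³ ⊗ ∂₄ - dx⁴ ⊗ ∂₃` of `ℝ⁴ = ℂ²`. -/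
def stdJ : R4 →L[ℝ] R4 :=
  LinearMap.toContinuousLinearMap
    { toFun := fun v => !₂[-(v 1), v 0, -(v 3), v 2]
      map_add' := by
        intro v w; ext i; fin_cases i <;> simp <;> ring
      map_smul' := by
        intro c v; ext i; fin_cases i <;> simp }

/-- The `2`-form `(v, w) ↦ B v w` of a bilinear form `B` on `ℝ⁴` with `B v v = 0`. -/
def twoFormOfBilin (B : R4 →L[ℝ] R4 →L[ℝ] ℝ) (hB : ∀ v, B v v = 0) : R4 [⋀^Fin 2]→L[ℝ] ℝ where
  toFun v := B (v 0) (v 1)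
  map_update_add' := by
    intro _ v i a b
    fin_cases i <;> simp
  map_update_smul' := by
    intro _ v i c a
    fin_cases i <;> simp
  map_eq_zero_of_eq' := by
    intro v i j hv hij
    fin_cases i <;> fin_cases j <;> simp_all
  cont := by fun_prop

/-- `⟨J₀ v, w⟩ = v¹ w² - v² w¹ + v³ w⁴ - v⁴ w³`. -/
theorem inner_stdJ (v w : R4) :
    innerSL ℝ (stdJ v) w = v 0 * w 1 - v 1 * w 0 + v 2 * w 3 - v 3 * w 2 := by
  simp [stdJ, PiLp.inner_apply, Fin.sum_univ_four]
  ring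

/-- The standard symplectic form `ω₀ = dx¹ ∧ dx² + dx³ ∧ dx⁴` of `ℝ⁴`. -/
def stdForm : R4 [⋀^Fin 2]→L[ℝ] ℝ :=
  twoFormOfBilin ((innerSL ℝ).comp stdJ) (by
    intro v
    rw [ContinuousLinearMap.comp_apply, inner_stdJ]
    ring)

theorem stdForm_apply (v : Fin 2 → R4) :
    stdForm v = (v 0 0 * v 1 1 - v 0 1 * v 1 0) + (v 0 2 * v 1 3 - v 0 3 * v 1 2) := by
  change innerSL ℝ (stdJ (v 0)) (v 1) = _
  rw [inner_stdJ]
  ring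

/-- The unitary group `U(2)` acting on `ℝ⁴ = ℂ²`: the linear isometries that commute with `J₀`. -/
def unitaryTwo : Subgroup (R4 ≃ₗᵢ[ℝ] R4) where
  carrier := {γ | ∀ v, γ (stdJ v) = stdJ (γ v)}
  one_mem' := fun _ => rfl
  mul_mem' := by
    intro a b ha hb v
    simp only [mem_ofPred_eq] at ha hb
    simp [ha, hb]
  inv_mem' := by
    intro a ha v
    simp only [mem_ofPred_eq] at ha
    change a.symm (stdJ v) = stdJ (a.symm v)
    apply a.injective
    rw [ha, a.apply_symm_apply, a.apply_symm_apply]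

/-- The complement `{x | R < |x|}` of the closed ball of radius `R` about the origin. -/
def exterior (R : ℝ) : Set R4 := (Metric.closedBall 0 R)ᶜ

/-- A `C²` closed `4`-ball in `ℝ⁴` (the image of the standard one under a `C²` diffeomorphism of
`ℝ⁴`), whose boundary is the corresponding image of `S³`. -/
def IsC2Ball (D : Set R4) : Prop :=
  ∃ Ψ : R4 ≃ₘ^2⟮𝓘(ℝ, R4), 𝓘(ℝ, R4)⟯ R4,
    Ψ '' Metric.closedBall 0 1 = D ∧ Ψ '' Metric.sphere 0 1 = frontier D

/-! ### Kähler surfaces -/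

section Kahler

variable (M : Type*) [TopologicalSpace M] [ChartedSpace R4 M] [IsManifold 𝓘(ℝ, R4) ∞ M]

/-- An almost Hermitian structure `(g, J)` on a smooth `4`-manifold, with `g` of class `C²`. -/
structure AlmostHermitian where
  /-- the Riemannian metric -/
  g : ContMDiffRiemannianMetric 𝓘(ℝ, R4) 2 R4 (fun x : M => TangentSpace 𝓘(ℝ, R4) x)
  /-- the almost complex structure -/
  J : ∀ x : M, TangentSpace 𝓘(ℝ, R4) x →L[ℝ] TangentSpace 𝓘(ℝ, R4) x
  J_sq : ∀ x v, J x (J x v) = -v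
  compat : ∀ x v w, g.inner x (J x v) (J x w) = g.inner x v w

variable {M}

theorem AlmostHermitian.inner_J_self (S : AlmostHermitian M) (x : M)
    (v : TangentSpace 𝓘(ℝ, R4) x) : S.g.inner x (S.J x v) v = 0 := by
  have h1 := S.compat x (S.J x v) v
  rw [S.J_sq, map_neg, neg_apply, S.g.symm x v] at h1
  linarith

/-- The Kähler form `ω = g(J ·, ·)`. -/
def AlmostHermitian.kahlerForm (S : AlmostHermitian M) (x : M) :
    TangentSpace 𝓘(ℝ, R4) x [⋀^Fin 2]→L[ℝ] ℝ :=
  twoFormOfBilin ((S.g.inner x).comp (S.J x)) (S.inner_J_self x)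

/-- The pull-back of a `2`-form on `M` by a map from `ℝ⁴` to `M`. -/
def pullbackForm (η : ∀ x : M, TangentSpace 𝓘(ℝ, R4) x [⋀^Fin 2]→L[ℝ] ℝ) (q : R4 → M) (y : R4) :
    R4 [⋀^Fin 2]→L[ℝ] ℝ :=
  (η (q y)).compContinuousLinearMap (mfderiv 𝓘(ℝ, R4) 𝓘(ℝ, R4) q y)

/-- The component `g_{jk}` of the pull-back of `g` by a map from `ℝ⁴` to `M`. -/
def AlmostHermitian.metricCoeff (S : AlmostHermitian M) (q : R4 → M) (j k : Fin 4) (y : R4) : ℝ :=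
  S.g.inner (q y) (mfderiv 𝓘(ℝ, R4) 𝓘(ℝ, R4) q y (EuclideanSpace.single j (1 : ℝ) : R4))
    (mfderiv 𝓘(ℝ, R4) 𝓘(ℝ, R4) q y (EuclideanSpace.single k (1 : ℝ) : R4))

variable (M)

/-- A Kähler surface: around every point there are smooth coordinates in which `J` is the standard
complex structure of `ℂ²` (so that `J` is a complex structure), and the Kähler form is closed,
`dω = 0` in all smooth coordinates. -/
structure KahlerSurface extends AlmostHermitian M where
  integrable : ∀ x : M, ∃ φ ∈ IsManifold.maximalAtlas 𝓘(ℝ, R4) ∞ M, x ∈ φ.source ∧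
    ∀ y ∈ φ.source, ∀ v : TangentSpace 𝓘(ℝ, R4) y,
      mfderiv 𝓘(ℝ, R4) 𝓘(ℝ, R4) φ y (J y v) = stdJ (mfderiv 𝓘(ℝ, R4) 𝓘(ℝ, R4) φ y v)
  closed : ∀ φ ∈ IsManifold.maximalAtlas 𝓘(ℝ, R4) ∞ M, ∀ y ∈ φ.target,
    extDeriv (pullbackForm toAlmostHermitian.kahlerForm φ.symm) y = 0

variable {M}

/-! ### Ends and asymptotic coordinates -/

/-- The connected components of the complement of `K`. -/
def ends (K : Set M) : Set (Set M) := {U | ∃ x ∈ Kᶜ, U = connectedComponentIn Kᶜ x}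

/-- `q` induces a diffeomorphism `(ℝ⁴ - D)/Γ ≅ U`, where `D` is the closed ball of radius `R` and
`Γ ⊂ O(4)` is a finite group that acts freely on the unit sphere. -/
structure IsQuotientChart (Γ : Subgroup (R4 ≃ₗᵢ[ℝ] R4)) (R : ℝ) (U : Set M) (q : R4 → M) :
    Prop where
  finite : Finite Γ
  free : ∀ γ ∈ Γ, γ ≠ 1 → ∀ v : R4, ‖v‖ = 1 → γ v ≠ v
  pos : 0 < R
  localDiffeo : IsLocalDiffeomorphOn 𝓘(ℝ, R4) 𝓘(ℝ, R4) ∞ q (exterior R)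
  image_eq : q '' exterior R = U
  fiber : ∀ y ∈ exterior R, ∀ z ∈ exterior R, q y = q z ↔ ∃ γ ∈ Γ, γ y = z

/-- Completeness of `M` with respect to the Riemannian distance of `g`. -/
def AlmostHermitian.IsComplete (S : AlmostHermitian M) : Prop :=
  letI : RiemannianBundle (fun x : M => TangentSpace 𝓘(ℝ, R4) x) := ⟨S.g.toRiemannianMetric⟩
  ∀ u : ℕ → M,
    (∀ δ > 0, ∃ N, ∀ m ≥ N, ∀ n ≥ N, riemannianEDist 𝓘(ℝ, R4) (u m) (u n) < δ) →
      ∃ x, Tendsto u atTop (𝓝 x)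

/-- `(M, g, J)` is ALE and the components of `M - K` are its ends: `M` is connected, non-compact
and complete, `K` is compact, `M - K` has finitely many components, and each of them is a quotient
`(ℝ⁴ - D)/Γ` in such a way that `g` satisfies
`g_{jk} = δ_{jk} + O(|x|^{-1-ε})` and `g_{jk,l} = O(|x|^{-2-ε})` for some `ε > 0`. -/
structure KahlerSurface.IsALE (S : KahlerSurface M) (K : Set M) : Prop where
  connected : ConnectedSpace M
  noncompact : NoncompactSpace M
  complete : S.IsComplete
  compact : IsCompact K
  finite_ends : (ends K).Finite
  chart : ∀ U ∈ ends K, ∃ (Γ : Subgroup (R4 ≃ₗᵢ[ℝ] R4)) (R : ℝ) (q : R4 → M) (ε : ℝ),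
    0 < ε ∧ IsQuotientChart Γ R U q ∧
    (∀ j k, (fun y => S.metricCoeff q j k y - if j = k then 1 else 0)
      =O[Bornology.cobounded R4] (fun y => ‖y‖ ^ (-1 - ε))) ∧
    (∀ j k l, (fun y => fderiv ℝ (S.metricCoeff q j k) y (EuclideanSpace.single l 1))
      =O[Bornology.cobounded R4] (fun y => ‖y‖ ^ (-2 - ε)))

variable {M' : Type*} [TopologicalSpace M'] [ChartedSpace R4 M']

/-- `p : M' → M` is the universal cover of the open set `U` of `M`, with the smooth structure
induced from `U`. -/
structure IsUniversalCover (p : M' → M) (U : Set M) : Prop where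
  simplyConnected : SimplyConnectedSpace M'
  range_eq : range p = U
  covering : IsCoveringMapOn p U
  localDiffeo : IsLocalDiffeomorph 𝓘(ℝ, R4) 𝓘(ℝ, R4) ∞ p

/-- `x : M' → ℝ⁴ - B` is a diffeomorphism, where `B` is the closed ball of radius `R`, in which
the deck transformations of `p : M' → M` are represented by the elements of `Γ`. -/
structure IsAsymptoticCoordinates (p : M' → M) (R : ℝ) (Γ : Subgroup (R4 ≃ₗᵢ[ℝ] R4))
    (x : OpenPartialHomeomorph M' R4) : Prop where
  source_eq : x.source = univ
  target_eq : x.target = exterior R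
  contMDiff : ContMDiff 𝓘(ℝ, R4) 𝓘(ℝ, R4) ∞ x
  contMDiffOn_symm : ContMDiffOn 𝓘(ℝ, R4) 𝓘(ℝ, R4) ∞ x.symm (exterior R)
  deck : ∀ τ : M' ≃ₜ M', (∀ m, p (τ m) = p m) → ∃ γ ∈ Γ, ∀ m, x (τ m) = γ (x m)
  deck_surj : ∀ γ ∈ Γ, ∃ τ : M' ≃ₜ M', (∀ m, p (τ m) = p m) ∧ ∀ m, x (τ m) = γ (x m)

/-- The expression of the Kähler form of `M` in coordinates `x` on a covering `p : M' → M`. -/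
def KahlerSurface.coordForm (S : KahlerSurface M) (p : M' → M) (x : OpenPartialHomeomorph M' R4) :
    R4 → R4 [⋀^Fin 2]→L[ℝ] ℝ :=
  pullbackForm S.kahlerForm (p ∘ x.symm)

end Kahler

end

/-!
The proof is Moser's isotopy argument at infinity. In the asymptotic coordinates the Kähler form
is a closed `C²` two-form `ω = ω₀ + η` on the exterior of a ball, invariant under `Γ`, with
`η = O(|x|^{-1-ε})` and `∇η = O(|x|^{-2-ε})`. If `η = dα` near infinity with `α` invariant and of
class `C²`, `α = O(|x|^{-ε})` and `∇α = O(|x|^{-1-ε})`, then the field `X_t` defined by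
`ι_{X_t} (ω₀ + t η) = -α` is `C²` and decays like `α`, the time-one map `Ψ` of its flow pulls `ω`
back to `ω₀` near infinity, and `Ψ` is asymptotic to the identity at the required rates.

The primitive. No decay of second derivatives of `η` is available, `ε` may be any positive number,
and `α` has to be `C²`, since otherwise `Ψ` would not be. The radial homotopy formula from infinity
does not give this: the integral for `α` need not converge for `ε ≤ 1`, nor, for any `ε`, that for
the second derivatives of `α`. Instead, one uses a homotopy from the identity to a *random*
rotation `g`, through multiples of rotations by factors in `[1/4, 1]`
(`exists_primitive_of_random_homotopy`). The homotopy formula expresses `g^*η - η` as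
the differential of an integral over a bounded path, which involves `η` only at distances
comparable with `|x|`, so the regularity and the decay of `η` pass to it. The expectation of `g^*η`
vanishes, because there is no non-zero rotation-invariant two-form on `ℝ⁴ - 0`: the rotations
used are `x ↦ q x n` on the quaternions, with `q` a uniform unit quaternion and
`n ∈ {1, i, j, k}`, and after a right translation of `q` the sum over `n` of the values at `x`
becomes a sum of an alternating form over conjugations by `1, i, j, k`, which is `0` by
orthogonality of the characters of the Klein four-group (`sum_integral_sandwich_eq_zero`).
The outcome is `exists_primitive`; averaging over `Γ` makes the primitive invariant
(`exists_invariant_average`).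

The flow. Cut off far from the origin, the field `X_t` has spatial derivative at most `1/4`
everywhere. Then the integral equation of the flow is a perturbation of the identity on
`C([0, 1], ℝ⁴)`, and superposition operators of `C²` maps are `C²`, so the flow exists globally
and is `C²` in the initial value (`exists_flow`); its time-one map is again a perturbation of the
identity, hence a global `C²` diffeomorphism of `ℝ⁴` (`exists_moser_diffeo`). So `D` is the image
under `Ψ` of a large closed ball, and `Φ` the restriction of `Ψ` to its exterior.

The coordinate expression of `ω` is closed because the covering map, read in the coordinates, is
locally the inverse of a chart of the maximal atlas (`KahlerSurface.extDeriv_coordForm`), and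
invariant because the elements of `Γ` represent deck transformations
(`KahlerSurface.coordForm_map`). Two-forms on `ℝ⁴` are handled as fields of bilinear forms
`R4 →L[ℝ] R4 →L[ℝ] ℝ` (`bilinOfForm`), so that their derivatives can be evaluated one vector at a
time.
-/

/-! ### Superposition operators on spaces of continuous maps -/

section Superposition

-- instances on iterated spaces of continuous linear maps are found only at this depth
set_option maxSynthPendingDepth 3

universe u

variable {K : Type*} [TopologicalSpace K]
  {P E F : Type u} [NormedAddCommGroup P] [NormedAddCommGroup E] [NormedAddCommGroup F]

/-- The superposition (Nemytskii) operator `u ↦ (k ↦ f (k, u k))`. -/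
def superposition (f : C(K × E, F)) (u : C(K, E)) : C(K, F) :=
  ⟨fun k => f (k, u k), by fun_prop⟩

@[simp] theorem superposition_apply (f : C(K × E, F)) (u : C(K, E)) (k : K) :
    superposition f u k = f (k, u k) := rfl

variable [CompactSpace K]

/-- A continuous map is uniformly continuous in the second variable along a compact graph. -/
theorem eventually_forall_norm_sub_lt (f : C(K × E, F)) (u : C(K, E)) {ε : ℝ} (hε : 0 < ε) :
    ∀ᶠ y in 𝓝 (0 : E), ∀ k ∈ (univ : Set K), ‖f (k, u k + y) - f (k, u k)‖ < ε := by
  refine isCompact_univ.eventually_forall_of_forall_eventually fun k _ => ?_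
  have hc : Continuous fun z : E × K => ‖f (z.2, u z.2 + z.1) - f (z.2, u z.2)‖ := by fun_prop
  exact hc.continuousAt.eventually_lt continuousAt_const (by simpa using hε)

theorem continuous_superposition (f : C(K × E, F)) : Continuous (superposition f) := by
  rw [Metric.continuous_iff]
  intro u ε hε
  obtain ⟨δ, hδ, h⟩ := Metric.eventually_nhds_iff_ball.1 (eventually_forall_norm_sub_lt f u hε)
  refine ⟨δ, hδ, fun v hv => ?_⟩
  rw [ContinuousMap.dist_lt_iff hε]
  intro k
  have := h (v k - u k) (by
    rw [mem_ball_zero_iff, ← dist_eq_norm]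
    exact (ContinuousMap.dist_apply_le_dist k).trans_lt hv) k (mem_univ k)
  simpa [dist_eq_norm] using this

variable [NormedSpace ℝ P] [NormedSpace ℝ E] [NormedSpace ℝ F]

/-- Pointwise application of a continuous family of operators to a continuous map. -/
noncomputable def pointwiseApply : C(K, E →L[ℝ] F) →L[ℝ] C(K, E) →L[ℝ] C(K, F) :=
  LinearMap.mkContinuous₂
    (LinearMap.mk₂ ℝ (fun (A : C(K, E →L[ℝ] F)) (u : C(K, E)) =>
        (⟨fun k => A k (u k), A.continuous.clm_apply u.continuous⟩ : C(K, F)))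
      (fun _ _ _ => by ext; simp) (fun _ _ _ => by ext; simp)
      (fun _ _ _ => by ext; simp) (fun _ _ _ => by ext; simp)) 1 (by
    intro A u
    rw [one_mul, ContinuousMap.norm_le _ (by positivity)]
    intro k
    exact (A k).le_of_opNorm_le_of_le (A.norm_coe_le_norm k) (u.norm_coe_le_norm k))

theorem norm_pointwiseApply_le (A : C(K, E →L[ℝ] F)) : ‖pointwiseApply A‖ ≤ ‖A‖ := by
  refine ContinuousLinearMap.opNorm_le_bound _ (norm_nonneg A) fun u => ?_
  rw [ContinuousMap.norm_le _ (by positivity)]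
  intro k
  exact (A k).le_of_opNorm_le_of_le (A.norm_coe_le_norm k) (u.norm_coe_le_norm k)

theorem hasFDerivAt_superposition (f : C(K × E, F)) (f' : C(K × E, E →L[ℝ] F))
    (h : ∀ k x, HasFDerivAt (fun y => f (k, y)) (f' (k, x)) x) (u : C(K, E)) :
    HasFDerivAt (superposition f) (pointwiseApply (superposition f' u)) u := by
  rw [hasFDerivAt_iff_isLittleO_nhds_zero, isLittleO_iff]
  intro ε hε
  -- uniform continuity of `f'` near the graph of `u`, by compactness of `K`
  have h1 := eventually_forall_norm_sub_lt f' u hε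
  obtain ⟨δ, hδ, h2⟩ := Metric.eventually_nhds_iff_ball.1 h1
  filter_upwards [Metric.ball_mem_nhds (0 : C(K, E)) hδ] with w hw
  rw [mem_ball_zero_iff] at hw
  rw [ContinuousMap.norm_le _ (by positivity)]
  intro k
  have hwk : ‖w k‖ < δ := (w.norm_coe_le_norm k).trans_lt hw
  have h3 := (convex_ball (u k) δ).norm_image_sub_le_of_norm_hasFDerivWithin_le'
    (f := fun y => f (k, y)) (f' := fun y => f' (k, y)) (φ := f' (k, u k)) (C := ε)
    (x := u k) (y := u k + w k)
    (fun y _ => (h k y).hasFDerivWithinAt) (fun y hy => by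
      have := h2 (y - u k) (by simpa [dist_eq_norm] using hy) k (mem_univ k)
      simpa using this.le) (by simpa using hδ) (by simpa [dist_eq_norm] using hwk)
  simp only [add_sub_cancel_left] at h3
  exact h3.trans (mul_le_mul_of_nonneg_left (w.norm_coe_le_norm k) hε.le)

/-- The superposition operator of a map that is jointly `C^n` in the parameter and the
variable is `C^n` on the Banach space of continuous maps. -/
theorem contDiff_superposition (n : ℕ) {O : Set (P × E)} (hO : IsOpen O) (κ : C(K, P))
    (hκ : ∀ k x, (κ k, x) ∈ O) {g : P × E → F} (hg : ContDiffOn ℝ n g O) (f : C(K × E, F))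
    (hf : ∀ z, f z = g (κ z.1, z.2)) : ContDiff ℝ n (superposition f) := by
  induction n generalizing F with
  | zero => exact contDiff_zero.2 (continuous_superposition f)
  | succ n ih =>
    push_cast at hg
    rw [contDiffOn_succ_iff_fderiv_of_isOpen hO] at hg
    obtain ⟨hd, -, hg'⟩ := hg
    have hg2 : ContDiffOn ℝ n
        (fun z => (fderiv ℝ g z).comp (ContinuousLinearMap.inr ℝ P E)) O :=
      hg'.clm_comp contDiffOn_const
    let f' : C(K × E, E →L[ℝ] F) :=
      ⟨fun z => (fderiv ℝ g (κ z.1, z.2)).comp (ContinuousLinearMap.inr ℝ P E),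
        hg2.continuousOn.comp_continuous (by fun_prop) (fun z => hκ _ _)⟩
    push_cast
    rw [contDiff_succ_iff_hasFDerivAt]
    have h0 : ContDiff ℝ n (superposition f') := ih hg2 f' fun z => rfl
    have h1 : ContDiff ℝ n (fun u => pointwiseApply (superposition f' u)) :=
      ContDiff.comp (g := (pointwiseApply (K := K) (E := E) (F := F) : _ → _))
        (ContinuousLinearMap.contDiff _) h0
    refine ⟨fun u => pointwiseApply (superposition f' u), h1, fun u => ?_⟩
    refine hasFDerivAt_superposition f f' (fun k x => ?_) u
    have h1 : HasFDerivAt g (fderiv ℝ g (κ k, x)) (κ k, x) :=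
      (hd.differentiableAt (hO.mem_nhds (hκ k x))).hasFDerivAt
    have h2 := h1.comp x (hasFDerivAt_prodMk_right (κ k) x)
    exact h2.congr_of_eventuallyEq (Eventually.of_forall fun y => hf (k, y))

end Superposition

/-! ### Integrals depending on a parameter -/

section ParametricIntegral

open MeasureTheory

universe u

set_option maxSynthPendingDepth 3

variable {Θ : Type*} [MeasurableSpace Θ] {P E F : Type u} [NormedAddCommGroup P]
  [NormedSpace ℝ P] [FiniteDimensional ℝ P] [MeasurableSpace P] [BorelSpace P]
  [NormedAddCommGroup E] [NormedSpace ℝ E]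
  [NormedAddCommGroup F]

theorem integrable_comp_of_bounded {μ : Measure Θ} [IsFiniteMeasure μ] {m : Θ → P}
    (hm : Measurable m) {C : ℝ} (hC : ∀ θ, ‖m θ‖ ≤ C) {φ : P → F} (hφ : Continuous φ) :
    Integrable (fun θ => φ (m θ)) μ := by
  have : ProperSpace P := FiniteDimensional.proper ℝ P
  obtain ⟨B, hB⟩ := (isCompact_closedBall (0 : P) C).exists_bound_of_continuousOn
    hφ.continuousOn
  refine Integrable.of_bound (C := B) ?_ (Eventually.of_forall fun θ => hB _ (by simpa using hC θ))
  exact (hφ.stronglyMeasurable.comp_measurable hm).aestronglyMeasurable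

variable [NormedSpace ℝ F]

/-- Differentiation under the integral sign, for a bounded measurable family of parameters. -/
theorem contDiff_integral_comp (n : ℕ) (μ : Measure Θ) [IsFiniteMeasure μ] {m : Θ → P}
    (hm : Measurable m) {C : ℝ} (hC : ∀ θ, ‖m θ‖ ≤ C) {g : P × E → F} (hg : ContDiff ℝ n g) :
    ContDiff ℝ n (fun x => ∫ θ, g (m θ, x) ∂μ) ∧
    (n ≠ 0 → ∀ x, HasFDerivAt (fun x => ∫ θ, g (m θ, x) ∂μ)
      (∫ θ, (fderiv ℝ g (m θ, x)).comp (ContinuousLinearMap.inr ℝ P E) ∂μ) x) := by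
  have : ProperSpace P := FiniteDimensional.proper ℝ P
  let K := Metric.closedBall (0 : P) C
  have : CompactSpace K := isCompact_iff_compactSpace.1 (isCompact_closedBall 0 C)
  let m' : Θ → K := fun θ => ⟨m θ, by simpa [K] using hC θ⟩
  have hm' : Measurable m' := hm.subtype_mk
  have hint : ∀ φ : C(K, F), Integrable (fun θ => φ (m' θ)) μ := fun φ =>
    Integrable.of_bound (C := ‖φ‖)
      (φ.continuous.stronglyMeasurable.comp_measurable hm').aestronglyMeasurable
      (Eventually.of_forall fun θ => φ.norm_coe_le_norm _)
  let I : C(K, F) →L[ℝ] F := LinearMap.mkContinuous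
    { toFun := fun φ => ∫ θ, φ (m' θ) ∂μ
      map_add' := fun φ ψ => integral_add (hint φ) (hint ψ)
      map_smul' := fun c φ => integral_smul c _ } (μ.real univ) (by
    intro φ
    have := norm_integral_le_of_norm_le_const (μ := μ)
      (Eventually.of_forall fun θ => φ.norm_coe_le_norm (m' θ))
    simpa [mul_comm] using this)
  let κ : C(K, P) := ⟨Subtype.val, continuous_subtype_val⟩
  let cst : E →L[ℝ] C(K, E) := LinearMap.mkContinuous
    { toFun := fun x => ContinuousMap.const K x
      map_add' := fun _ _ => rfl
      map_smul' := fun _ _ => rfl } 1 (by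
    intro x
    rw [ContinuousMap.norm_le _ (by positivity), one_mul]
    exact fun _ => le_rfl)
  let f : C(K × E, F) := ⟨fun z => g (κ z.1, z.2), hg.continuous.comp (by fun_prop)⟩
  have hfun : (fun x => ∫ θ, g (m θ, x) ∂μ) = fun x => I (superposition f (cst x)) := rfl
  refine ⟨?_, fun hn x => ?_⟩
  · rw [hfun]
    exact I.contDiff.comp ((contDiff_superposition n isOpen_univ κ (fun _ _ => mem_univ _)
      hg.contDiffOn f fun z => rfl).comp cst.contDiff)
  · have hgd : Differentiable ℝ g := hg.differentiable (by exact_mod_cast hn)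
    have hcd : Continuous (fderiv ℝ g) := hg.continuous_fderiv (by exact_mod_cast hn)
    let f' : C(K × E, E →L[ℝ] F) :=
      ⟨fun z => (fderiv ℝ g (κ z.1, z.2)).comp (ContinuousLinearMap.inr ℝ P E), by
        have : Continuous fun z : K × E => fderiv ℝ g (κ z.1, z.2) :=
          hcd.comp (by fun_prop)
        exact this.clm_comp continuous_const⟩
    have h1 := hasFDerivAt_superposition f f' (fun k x => by
      exact (hgd _).hasFDerivAt.comp x (hasFDerivAt_prodMk_right (κ k) x)) (cst x)
    have h2 := I.hasFDerivAt.comp x (h1.comp x cst.hasFDerivAt)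
    rw [hfun]
    refine h2.congr_fderiv ?_
    ext v
    have hi : Integrable (fun θ =>
        (fderiv ℝ g (m θ, x)).comp (ContinuousLinearMap.inr ℝ P E)) μ :=
      integrable_comp_of_bounded hm hC
        (φ := fun p => (fderiv ℝ g (p, x)).comp (ContinuousLinearMap.inr ℝ P E)) (by
          have : Continuous fun p : P => fderiv ℝ g (p, x) := hcd.comp (by fun_prop)
          exact this.clm_comp continuous_const)
    rw [ContinuousLinearMap.integral_apply hi]
    rfl

end ParametricIntegral

/-! ### Perturbations of the identity -/

section Perturbation

variable {E : Type*} [NormedAddCommGroup E] [NormedSpace ℝ E]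

theorem lipschitz_sub_of_fderiv_sub_id {f : E → E} (hf : Differentiable ℝ f) {c : ℝ}
    (h : ∀ x, ‖fderiv ℝ f x - ContinuousLinearMap.id ℝ E‖ ≤ c) (x y : E) :
    ‖f x - f y - (x - y)‖ ≤ c * ‖x - y‖ :=
  convex_univ.norm_image_sub_le_of_norm_hasFDerivWithin_le'
    (φ := ContinuousLinearMap.id ℝ E) (f' := fun x => fderiv ℝ f x)
    (fun x _ => (hf x).hasFDerivAt.hasFDerivWithinAt)
    (fun x _ => h x) (mem_univ _) (mem_univ _)

/-- A `C^n` map whose derivative is uniformly close to the identity is a global `C^n`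
diffeomorphism. -/
theorem exists_homeomorph_of_fderiv_sub_id [CompleteSpace E] {f : E → E} {n : ℕ} (hn : n ≠ 0)
    (hf : ContDiff ℝ n f) {c : ℝ} (hc : c < 1)
    (h : ∀ x, ‖fderiv ℝ f x - ContinuousLinearMap.id ℝ E‖ ≤ c) :
    ∃ e : E ≃ₜ E, (∀ x, e x = f x) ∧ ContDiff ℝ n e.symm := by
  have hc0 : 0 ≤ c := (norm_nonneg _).trans (h 0)
  have hd : Differentiable ℝ f := hf.differentiable (by exact_mod_cast hn)
  have happ : ApproximatesLinearOn f ((ContinuousLinearEquiv.refl ℝ E : E ≃L[ℝ] E) : E →L[ℝ] E)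
      univ (⟨c, hc0⟩ : NNReal) := fun x _ y _ => lipschitz_sub_of_fderiv_sub_id hd h x y
  have hs : Subsingleton E ∨ (⟨c, hc0⟩ : NNReal) <
      ‖((ContinuousLinearEquiv.refl ℝ E).symm : E →L[ℝ] E)‖₊⁻¹ := by
    rcases subsingleton_or_nontrivial E with hE | hE
    · exact Or.inl hE
    · right
      have : ‖((ContinuousLinearEquiv.refl ℝ E).symm : E →L[ℝ] E)‖₊ = 1 := by
        ext; exact ContinuousLinearMap.norm_id
      rw [this, inv_one]
      exact hc
  let e := happ.toHomeomorph f hs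
  have he : ∀ x, e x = f x := fun x => rfl
  have hunit : ∀ x, IsUnit (fderiv ℝ f x) := fun x => by
    have h1 : ‖ContinuousLinearMap.id ℝ E - fderiv ℝ f x‖ < 1 := by
      rw [norm_sub_rev]; exact (h x).trans_lt hc
    have := (Units.oneSub _ h1).isUnit
    rwa [Units.val_oneSub, show (1 : E →L[ℝ] E) - (ContinuousLinearMap.id ℝ E - fderiv ℝ f x)
      = fderiv ℝ f x from sub_sub_cancel _ _] at this
  refine ⟨e, he, e.contDiff_symm
    (f₀' := fun x => ContinuousLinearEquiv.unitsEquiv ℝ E (hunit x).unit) (fun x => ?_) hf⟩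
  exact (hd x).hasFDerivAt

end Perturbation

/-! ### Flows of time-dependent vector fields with small derivative -/

section Flow

open intervalIntegral

set_option maxSynthPendingDepth 3

variable {E : Type} [NormedAddCommGroup E] [NormedSpace ℝ E]

theorem norm_integral_comp_projIcc_le (u : C(Icc (0 : ℝ) 1, E)) (t : Icc (0 : ℝ) 1) :
    ‖∫ s in (0 : ℝ)..t, u (projIcc 0 1 zero_le_one s)‖ ≤ ‖u‖ := by
  refine (norm_integral_le_of_norm_le_const (C := ‖u‖) fun s _ => u.norm_coe_le_norm _).trans ?_
  rw [sub_zero, abs_of_nonneg t.2.1]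
  exact mul_le_of_le_one_right (norm_nonneg _) t.2.2

theorem continuous_integral_comp_projIcc (u : C(Icc (0 : ℝ) 1, E)) :
    Continuous fun t : ℝ => ∫ s in (0 : ℝ)..t, u (projIcc 0 1 zero_le_one s) :=
  continuous_primitive (fun _ _ => (u.continuous.comp continuous_projIcc).intervalIntegrable _ _) 0

/-- The Volterra operator `u ↦ (t ↦ ∫₀ᵗ u)` on `C([0, 1], E)`. -/
noncomputable def volterra : C(Icc (0 : ℝ) 1, E) →L[ℝ] C(Icc (0 : ℝ) 1, E) :=
  LinearMap.mkContinuous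
    { toFun := fun u => ⟨fun t => ∫ s in (0 : ℝ)..t, u (projIcc 0 1 zero_le_one s),
        (continuous_integral_comp_projIcc u).comp continuous_subtype_val⟩
      map_add' := fun u v => by
        ext t
        exact integral_add ((u.continuous.comp continuous_projIcc).intervalIntegrable _ _)
          ((v.continuous.comp continuous_projIcc).intervalIntegrable _ _)
      map_smul' := fun c u => by
        ext t
        exact integral_smul c _ } 1 (by
    intro u
    rw [one_mul, ContinuousMap.norm_le _ (norm_nonneg u)]
    exact norm_integral_comp_projIcc_le u)

theorem volterra_apply (u : C(Icc (0 : ℝ) 1, E)) (t : Icc (0 : ℝ) 1) :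
    volterra u t = ∫ s in (0 : ℝ)..t, u (projIcc 0 1 zero_le_one s) := rfl

theorem norm_volterra_le : ‖(volterra : C(Icc (0 : ℝ) 1, E) →L[ℝ] _)‖ ≤ 1 :=
  LinearMap.mkContinuous_norm_le _ zero_le_one _

theorem eq_of_sub_volterra_eq_zero {u v : C(Icc (0 : ℝ) 1, E)} {x : E}
    (h : u - volterra v = ContinuousMap.const _ x) : u ⟨0, by simp⟩ = x := by
  have := DFunLike.congr_fun h ⟨0, by simp⟩
  simpa [volterra_apply] using this

variable [CompleteSpace E]

/-- A solution of `u = x + ∫ v` is differentiable with derivative `v`. -/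
theorem hasDerivWithinAt_of_sub_volterra_eq {u v : C(Icc (0 : ℝ) 1, E)} {x : E}
    (h : u - volterra v = ContinuousMap.const _ x) {t : ℝ} (ht : t ∈ Icc (0 : ℝ) 1) :
    HasDerivWithinAt (fun s => u (projIcc 0 1 zero_le_one s)) (v ⟨t, ht⟩) (Icc 0 1) t := by
  have hu : ∀ s ∈ Icc (0 : ℝ) 1, u (projIcc 0 1 zero_le_one s) =
      x + ∫ r in (0 : ℝ)..s, v (projIcc 0 1 zero_le_one r) := fun s hs => by
    have := DFunLike.congr_fun h ⟨s, hs⟩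
    rw [projIcc_of_mem _ hs]
    simp only [ContinuousMap.sub_apply, volterra_apply, ContinuousMap.const_apply] at this
    rw [← this, sub_add_cancel]
  have h1 := ((v.continuous.comp (continuous_projIcc (h := zero_le_one)))
    |>.integral_hasStrictDerivAt 0 t).hasDerivAt.const_add x
  have h2 := h1.hasDerivWithinAt (s := Icc (0 : ℝ) 1)
  simp only [Function.comp_apply] at h2
  rw [projIcc_of_mem _ ht] at h2
  exact h2.congr hu (hu t ht)

/-- The flow over `[0, 1]` of a time-dependent vector field `Y` of class `C^n` whose spatial
derivative is at most `1/4`: it exists globally, it is of class `C^n` in the initial value,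
and its spatial derivative solves the linearized equation. -/
theorem exists_flow {n : ℕ} (hn : n ≠ 0) {O : Set (ℝ × E)} (hO : IsOpen O)
    (hIcc : ∀ t ∈ Icc (0 : ℝ) 1, ∀ x, (t, x) ∈ O) {Y : ℝ × E → E} (hY : ContDiffOn ℝ n Y O)
    (hsmall : ∀ t ∈ Icc (0 : ℝ) 1, ∀ x,
      ‖(fderiv ℝ Y (t, x)).comp (ContinuousLinearMap.inr ℝ ℝ E)‖ ≤ 1 / 4) :
    ∃ φ : ℝ → E → E, (∀ t, ContDiff ℝ n (φ t)) ∧ (∀ x, φ 0 x = x) ∧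
      (∀ x, ∀ t ∈ Icc (0 : ℝ) 1,
        HasDerivWithinAt (fun s => φ s x) (Y (t, φ t x)) (Icc 0 1) t) ∧
      (∀ x v, ∀ t ∈ Icc (0 : ℝ) 1, HasDerivWithinAt (fun s => fderiv ℝ (φ s) x v)
        (fderiv ℝ Y (t, φ t x) (0, fderiv ℝ (φ t) x v)) (Icc 0 1) t) := by
  have hn1 : (1 : WithTop ℕ∞) ≤ n := by exact_mod_cast Nat.one_le_iff_ne_zero.2 hn
  have hn0 : (n : WithTop ℕ∞) ≠ 0 := by exact_mod_cast hn
  let κ : C(Icc (0 : ℝ) 1, ℝ) := ⟨Subtype.val, continuous_subtype_val⟩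
  have hκ : ∀ k x, (κ k, x) ∈ O := fun k x => hIcc k k.2 x
  let f : C(Icc (0 : ℝ) 1 × E, E) := ⟨fun z => Y (κ z.1, z.2),
    hY.continuousOn.comp_continuous (by fun_prop) fun z => hκ _ _⟩
  have hY' := hY.continuousOn_fderiv_of_isOpen hO hn1
  let f' : C(Icc (0 : ℝ) 1 × E, E →L[ℝ] E) :=
    ⟨fun z => (fderiv ℝ Y (κ z.1, z.2)).comp (ContinuousLinearMap.inr ℝ ℝ E),
      (hY'.comp_continuous (by fun_prop) fun z => hκ _ _).clm_comp continuous_const⟩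
  have hf' : ∀ k x, HasFDerivAt (fun y => f (k, y)) (f' (k, x)) x := fun k x =>
    ((hY.differentiableOn hn0).differentiableAt
      (hO.mem_nhds (hκ k x))).hasFDerivAt.comp x (hasFDerivAt_prodMk_right (κ k) x)
  let G : C(Icc (0 : ℝ) 1, E) → C(Icc (0 : ℝ) 1, E) := fun u => u - volterra (superposition f u)
  have hSn : ContDiff ℝ n (superposition f) := contDiff_superposition n hO κ hκ hY f fun _ => rfl
  have hGn : ContDiff ℝ n G := contDiff_id.sub
    ((volterra (E := E)).contDiff.comp (f := superposition f) hSn)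
  have hGd : ∀ u, HasFDerivAt G (ContinuousLinearMap.id ℝ _ -
      volterra.comp (pointwiseApply (superposition f' u))) u := fun u =>
    (hasFDerivAt_id u).sub
      ((volterra (E := E)).hasFDerivAt.comp (f := superposition f) u
        (hasFDerivAt_superposition f f' hf' u))
  have hGs : ∀ u, ‖fderiv ℝ G u - ContinuousLinearMap.id ℝ _‖ ≤ 1 / 4 := fun u => by
    rw [(hGd u).fderiv, sub_sub_cancel_left]
    refine (norm_neg (volterra.comp (pointwiseApply (superposition f' u)))).le.trans ?_
    refine (ContinuousLinearMap.opNorm_comp_le _ _).trans ?_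
    have h1 : ‖pointwiseApply (superposition f' u)‖ ≤ 1 / 4 :=
      (norm_pointwiseApply_le _).trans ((ContinuousMap.norm_le _ (by norm_num)).2
        fun k => hsmall k k.2 _)
    calc _ ≤ 1 * (1 / 4 : ℝ) := mul_le_mul norm_volterra_le h1
          (norm_nonneg (pointwiseApply (superposition f' u))) zero_le_one
      _ = 1 / 4 := one_mul _
  -- the integral equation `u - ∫ Y(s, u) = x` is solved by inverting `G` globally, so that
  -- smooth dependence on `x` comes with the solution
  obtain ⟨e, he, hes⟩ := exists_homeomorph_of_fderiv_sub_id hn hGn (by norm_num) hGs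
  let cst : E →L[ℝ] C(Icc (0 : ℝ) 1, E) := LinearMap.mkContinuous
    { toFun := fun x => ContinuousMap.const _ x
      map_add' := fun _ _ => rfl
      map_smul' := fun _ _ => rfl } 1 (by
    intro x
    rw [ContinuousMap.norm_le _ (by positivity), one_mul]
    exact fun _ => le_rfl)
  let path : E → C(Icc (0 : ℝ) 1, E) := fun x => e.symm (cst x)
  have hpath : ContDiff ℝ n path := hes.comp cst.contDiff
  have hpe : ∀ x, path x - volterra (superposition f (path x)) = ContinuousMap.const _ x :=
    fun x => by
      have : e (path x) = cst x := e.apply_symm_apply _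
      rwa [he] at this
  have hpd : ∀ x, HasFDerivAt path (fderiv ℝ path x) x := fun x =>
    (hpath.differentiable hn0 x).hasFDerivAt
  -- differentiating the integral equation in `x` gives the linearized equation
  have hlin : ∀ x v, fderiv ℝ path x v -
      volterra (pointwiseApply (superposition f' (path x)) (fderiv ℝ path x v)) =
      ContinuousMap.const _ v := fun x v => by
    have h1 := (hGd (path x)).comp x (hpd x)
    have h2 : G ∘ path = cst := funext fun x => hpe x
    rw [h2] at h1
    have h3 := DFunLike.congr_fun (h1.unique cst.hasFDerivAt) v
    exact h3
  let ev : Icc (0 : ℝ) 1 → C(Icc (0 : ℝ) 1, E) →L[ℝ] E := fun t => ContinuousMap.evalCLM ℝ t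
  let φ : ℝ → E → E := fun t x => path x (projIcc 0 1 zero_le_one t)
  have hφd : ∀ t x v, fderiv ℝ (φ t) x v = fderiv ℝ path x v (projIcc 0 1 zero_le_one t) :=
    fun t x v => by
      have h1 := (ev (projIcc 0 1 zero_le_one t)).hasFDerivAt.comp x (hpd x)
      have h2 : fderiv ℝ (φ t) x = _ := h1.fderiv
      rw [h2]; rfl
  refine ⟨φ, fun t => (ev _).contDiff.comp hpath, fun x => ?_, fun x t ht => ?_,
    fun x v t ht => ?_⟩
  · have := eq_of_sub_volterra_eq_zero (hpe x)
    simp only [φ, projIcc_left]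
    exact this
  · have := hasDerivWithinAt_of_sub_volterra_eq (hpe x) ht
    simp only [φ]
    rw [projIcc_of_mem _ ht]
    exact this
  · have := hasDerivWithinAt_of_sub_volterra_eq (hlin x v) ht
    simp only [hφd]
    simp only [φ]
    rw [projIcc_of_mem _ ht]
    exact this

end Flow

/-! ### Primitives of closed two-forms from random linear homotopies -/

section Primitive

open MeasureTheory

set_option maxSynthPendingDepth 3

variable {E : Type} [NormedAddCommGroup E] [NormedSpace ℝ E]

/-- `dη = 0` at `x`, for a two-form `η` given as a field of bilinear forms. The formula is that
of the exterior derivative when every `η x` is alternating; alternation is a separate hypothesis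
where it is needed. -/
def IsClosedFormAt (η : E → E →L[ℝ] E →L[ℝ] ℝ) (x : E) : Prop :=
  ∀ a b c, fderiv ℝ η x a b c - fderiv ℝ η x b a c + fderiv ℝ η x c a b = 0

/-- The `1`-form `v ↦ η_{g x}(g' x, g v)`, as a function of the pair `(g, g')` of linear maps
and of `x`: the integrand of the homotopy formula along a path of linear maps `g` with
velocity `g'`. -/
noncomputable def homotopyIntegrand (η : E → E →L[ℝ] E →L[ℝ] ℝ)
    (z : ((E →L[ℝ] E) × (E →L[ℝ] E)) × E) : E →L[ℝ] ℝ :=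
  (η (z.1.1 z.2) (z.1.2 z.2)).comp z.1.1

variable {η : E → E →L[ℝ] E →L[ℝ] ℝ}

theorem contDiff_homotopyIntegrand {n : WithTop ℕ∞} (hη : ContDiff ℝ n η) :
    ContDiff ℝ n (homotopyIntegrand η) := by
  unfold homotopyIntegrand
  have h1 : ContDiff ℝ n fun z : ((E →L[ℝ] E) × (E →L[ℝ] E)) × E => z.1.1 :=
    contDiff_fst.fst
  have h2 : ContDiff ℝ n fun z : ((E →L[ℝ] E) × (E →L[ℝ] E)) × E => z.1.2 :=
    contDiff_fst.snd
  exact ((hη.comp (h1.clm_apply contDiff_snd)).clm_apply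
    (h2.clm_apply contDiff_snd)).clm_comp h1

theorem fderiv_homotopyIntegrand (hη : ContDiff ℝ 1 η) (g g' : E →L[ℝ] E) (x u v : E) :
    (fderiv ℝ (homotopyIntegrand η) ((g, g'), x)).comp
      (ContinuousLinearMap.inr ℝ ((E →L[ℝ] E) × (E →L[ℝ] E)) E) u v =
    fderiv ℝ η (g x) (g u) (g' x) (g v) + η (g x) (g' u) (g v) := by
  have hd : HasFDerivAt (homotopyIntegrand η) (fderiv ℝ (homotopyIntegrand η) ((g, g'), x))
      ((g, g'), x) :=
    ((contDiff_homotopyIntegrand hη).differentiable one_ne_zero _).hasFDerivAt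
  have h1 := hd.comp x (hasFDerivAt_prodMk_right (g, g') x)
  have h2 : HasFDerivAt (fun y => η (g y)) ((fderiv ℝ η (g x)).comp g) x :=
    ((hη.differentiable one_ne_zero _).hasFDerivAt).comp x g.hasFDerivAt
  have h3 := (h2.clm_apply g'.hasFDerivAt).clm_comp (hasFDerivAt_const g x)
  have h4 := h1.unique h3
  rw [h4]
  simp
  ring

/-- The homotopy formula, infinitesimally: the derivative of the pull-back `g^*η` of a closed
form along a path of linear maps is the exterior derivative of the homotopy integrand. -/
theorem hasDerivAt_pullback_linear (hη : ContDiff ℝ 1 η) (halt : ∀ x v, η x v v = 0)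
    {g g' : ℝ → E →L[ℝ] E} {s : ℝ} (hg : HasDerivAt g (g' s) s) {x : E}
    (hcl : IsClosedFormAt η (g s x)) (u v : E) :
    HasDerivAt (fun s => η (g s x) (g s u) (g s v))
      ((fderiv ℝ (homotopyIntegrand η) ((g s, g' s), x)).comp
        (ContinuousLinearMap.inr ℝ ((E →L[ℝ] E) × (E →L[ℝ] E)) E) u v -
      (fderiv ℝ (homotopyIntegrand η) ((g s, g' s), x)).comp
        (ContinuousLinearMap.inr ℝ ((E →L[ℝ] E) × (E →L[ℝ] E)) E) v u) s := by
  have hga : ∀ w, HasDerivAt (fun s => g s w) (g' s w) s := fun w => by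
    simpa using hg.clm_apply (hasDerivAt_const s w)
  have h1 : HasDerivAt (fun s => η (g s x)) (fderiv ℝ η (g s x) (g' s x)) s :=
    ((hη.differentiable one_ne_zero _).hasFDerivAt).comp_hasDerivAt s (hga x)
  have h2 := (h1.clm_apply (hga u)).clm_apply (hga v)
  refine h2.congr_deriv ?_
  rw [fderiv_homotopyIntegrand hη, fderiv_homotopyIntegrand hη]
  have h3 := hcl (g' s x) (g s u) (g s v)
  have h4 : η (g s x) (g s u) (g' s v) = - η (g s x) (g' s v) (g s u) := by
    have := halt (g s x) (g s u + g' s v)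
    simp only [map_add, add_apply, halt] at this
    linarith
  simp only [add_apply, h4]
  linarith

variable [FiniteDimensional ℝ E] {Z : Type*} [MeasurableSpace Z]

/-- Let `g_z(s)`, `0 ≤ s ≤ 1`, be a random path of linear maps that starts at the identity, such
that the expectation of `g_z(1)^*η` vanishes. If `η` is closed along the paths, the expectation
of the homotopy formula gives a primitive of `η`. The paths are bounded and bounded below by
`κ`, so that the primitive at `x` and its derivative are controlled by `η` and its derivative at
points of norm at least `κ ‖x‖`, and it is as smooth as `η`: no derivative of `η` is lost, and no
integral over an unbounded ray occurs. -/
theorem exists_primitive_of_random_homotopy (ν : Measure Z) [IsProbabilityMeasure ν]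
    {g g' : Z → ℝ → E →L[ℝ] E} (hgm : Measurable fun θ : Z × ℝ => g θ.1 θ.2)
    (hgm' : Measurable fun θ : Z × ℝ => g' θ.1 θ.2) {C κ : ℝ}
    (hgC : ∀ z, ∀ s ∈ Icc (0 : ℝ) 1, ‖g z s‖ ≤ C) (hgC' : ∀ z, ∀ s ∈ Icc (0 : ℝ) 1, ‖g' z s‖ ≤ C)
    (hgκ : ∀ z, ∀ s ∈ Icc (0 : ℝ) 1, ∀ x, κ * ‖x‖ ≤ ‖g z s x‖)
    (hg : ∀ z s, HasDerivAt (g z) (g' z s) s) (hgc : ∀ z, Continuous (g' z))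
    (hg0 : ∀ z, g z 0 = ContinuousLinearMap.id ℝ E)
    (hη : ContDiff ℝ 2 η) (halt : ∀ x v, η x v v = 0)
    (hkill : ∀ x, x ≠ 0 → ∀ u v, ∫ z, η (g z 1 x) (g z 1 u) (g z 1 v) ∂ν = 0)
    {r : ℝ} (hcl : ∀ x, r ≤ ‖x‖ → IsClosedFormAt η x) :
    ∃ α : E → E →L[ℝ] ℝ, ContDiff ℝ 2 α ∧
      (∀ x, x ≠ 0 → r ≤ κ * ‖x‖ → ∀ u v, fderiv ℝ α x u v - fderiv ℝ α x v u = η x u v) ∧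
      (∀ x B, (∀ y, κ * ‖x‖ ≤ ‖y‖ → ‖η y‖ ≤ B) → ‖α x‖ ≤ C ^ 2 * (‖x‖ * B)) ∧
      (∀ x B B', (∀ y, κ * ‖x‖ ≤ ‖y‖ → ‖η y‖ ≤ B) →
        (∀ y, κ * ‖x‖ ≤ ‖y‖ → ‖fderiv ℝ η y‖ ≤ B') →
        ‖fderiv ℝ α x‖ ≤ C ^ 3 * (‖x‖ * B') + C ^ 2 * B) := by
  have hη1 : ContDiff ℝ 1 η := hη.of_le one_le_two
  obtain ⟨z₀⟩ : Nonempty Z := ν.nonempty_of_neZero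
  have hC : 0 ≤ C := (norm_nonneg _).trans (hgC z₀ 0 (by simp))
  have : ProperSpace (E →L[ℝ] E) := FiniteDimensional.proper ℝ _
  let μ : Measure (Z × ℝ) := ν.prod (volume.restrict (Ioc 0 1))
  have hμ : μ.real univ = 1 := by
    simp [μ, measureReal_def, ← univ_prod_univ, Measure.prod_prod]
  -- the paths are bounded for `s ∈ [0, 1]` only; `m` vanishes for other `s`
  let m₀ : Z × ℝ → (E →L[ℝ] E) × (E →L[ℝ] E) := fun θ => (g θ.1 θ.2, g' θ.1 θ.2)
  let m : Z × ℝ → (E →L[ℝ] E) × (E →L[ℝ] E) := (univ ×ˢ Icc 0 1).indicator m₀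
  have hm : Measurable m :=
    (hgm.prodMk hgm').indicator (MeasurableSet.univ.prod measurableSet_Icc)
  have hmeq : ∀ z, ∀ s ∈ Icc (0 : ℝ) 1, m (z, s) = (g z s, g' z s) := fun z s hs =>
    indicator_of_mem (s := univ ×ˢ Icc (0 : ℝ) 1) (by simpa using hs) m₀
  have hmC : ∀ θ, ‖m θ‖ ≤ C := by
    rintro ⟨z, s⟩
    by_cases hs : s ∈ Icc (0 : ℝ) 1
    · rw [hmeq z s hs]
      exact max_le (hgC z s hs) (hgC' z s hs)
    · have : m (z, s) = 0 :=
        indicator_of_notMem (s := univ ×ˢ Icc (0 : ℝ) 1) (by simpa using hs) m₀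
      rw [this, norm_zero]
      exact hC
  obtain ⟨hα2, hαd⟩ := contDiff_integral_comp (E := E) 2 μ hm hmC
    (contDiff_homotopyIntegrand hη)
  have hαd := hαd two_ne_zero
  have hae : ∀ᵐ θ ∂μ, θ.2 ∈ Icc (0 : ℝ) 1 := by
    have h1 : ∀ᵐ s ∂(volume.restrict (Ioc (0 : ℝ) 1)), s ∈ Icc (0 : ℝ) 1 :=
      (ae_restrict_mem measurableSet_Ioc).mono fun s hs => Ioc_subset_Icc_self hs
    exact Measure.quasiMeasurePreserving_snd.ae h1
  have hcont : ∀ x, Continuous fun p : (E →L[ℝ] E) × (E →L[ℝ] E) =>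
      (fderiv ℝ (homotopyIntegrand η) (p, x)).comp
        (ContinuousLinearMap.inr ℝ ((E →L[ℝ] E) × (E →L[ℝ] E)) E) := fun x =>
    (((contDiff_homotopyIntegrand hη1).continuous_fderiv one_ne_zero).comp
      (by fun_prop)).clm_comp continuous_const
  have hfd : ∀ x, fderiv ℝ (fun x => -∫ θ, homotopyIntegrand η (m θ, x) ∂μ) x =
      -∫ θ, (fderiv ℝ (homotopyIntegrand η) (m θ, x)).comp
        (ContinuousLinearMap.inr ℝ ((E →L[ℝ] E) × (E →L[ℝ] E)) E) ∂μ := fun x =>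
    (hαd x).neg.fderiv
  refine ⟨fun x => -∫ θ, homotopyIntegrand η (m θ, x) ∂μ, hα2.neg, ?_, ?_, ?_⟩
  · intro x hx0 hx u v
    set D : Z × ℝ → E →L[ℝ] E →L[ℝ] ℝ := fun θ =>
      (fderiv ℝ (homotopyIntegrand η) (m θ, x)).comp
        (ContinuousLinearMap.inr ℝ ((E →L[ℝ] E) × (E →L[ℝ] E)) E) with hD
    have hDi : Integrable D μ := integrable_comp_of_bounded hm hmC (hcont x)
    have hDi2 : ∀ u v, Integrable (fun θ => D θ u v) μ := fun u v =>
      (hDi.apply_continuousLinearMap u).apply_continuousLinearMap v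
    have happ : ∀ u v, (∫ θ, D θ ∂μ) u v = ∫ θ, D θ u v ∂μ := fun u v => by
      rw [ContinuousLinearMap.integral_apply hDi,
        ContinuousLinearMap.integral_apply (hDi.apply_continuousLinearMap u)]
    -- the homotopy formula along one path, integrated in `s`
    have hslice : ∀ z, ∫ s, (D (z, s) u v - D (z, s) v u) ∂(volume.restrict (Ioc 0 1)) =
        η (g z 1 x) (g z 1 u) (g z 1 v) - η x u v := fun z => by
      have hder : ∀ s ∈ uIcc (0 : ℝ) 1, HasDerivAt (fun s => η (g z s x) (g z s u) (g z s v))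
          ((fderiv ℝ (homotopyIntegrand η) ((g z s, g' z s), x)).comp
            (ContinuousLinearMap.inr ℝ ((E →L[ℝ] E) × (E →L[ℝ] E)) E) u v -
          (fderiv ℝ (homotopyIntegrand η) ((g z s, g' z s), x)).comp
            (ContinuousLinearMap.inr ℝ ((E →L[ℝ] E) × (E →L[ℝ] E)) E) v u) s := fun s hs => by
        rw [uIcc_of_le zero_le_one] at hs
        exact hasDerivAt_pullback_linear hη1 halt (hg z s)
          (hcl _ (hx.trans (hgκ z s hs x))) u v
      have hgz : Continuous (g z) :=
        continuous_iff_continuousAt.2 fun s => (hg z s).continuousAt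
      have hcz := (hcont x).comp (hgz.prodMk (hgc z))
      have h1 := intervalIntegral.integral_eq_sub_of_hasDerivAt hder
        (Continuous.intervalIntegrable
          (((hcz.clm_apply continuous_const).clm_apply continuous_const).sub
          ((hcz.clm_apply continuous_const).clm_apply continuous_const)) _ _)
      rw [intervalIntegral.integral_of_le zero_le_one] at h1
      simp only [hg0, ContinuousLinearMap.id_apply] at h1
      rw [← h1]
      refine setIntegral_congr_fun measurableSet_Ioc fun s hs => ?_
      simp only [hD]
      rw [hmeq z s (Ioc_subset_Icc_self hs)]
    have hbd : Integrable (fun z => η (g z 1 x) (g z 1 u) (g z 1 v)) ν := by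
      have hg1 : Measurable fun z => g z 1 := hgm.comp (measurable_id.prodMk measurable_const)
      refine integrable_comp_of_bounded (m := fun z => g z 1) hg1
        (fun z => hgC z 1 (by simp)) (φ := fun A => η (A x) (A u) (A v)) ?_
      have hap : ∀ w : E, Continuous fun A : E →L[ℝ] E => A w := fun w => by fun_prop
      exact ((hη.continuous.comp (hap x)).clm_apply (hap u)).clm_apply (hap v)
    rw [hfd]
    simp only [neg_apply]
    rw [happ, happ, neg_sub_neg, ← integral_sub (hDi2 v u) (hDi2 u v),
      integral_prod (fun θ => D θ v u - D θ u v) ((hDi2 v u).sub (hDi2 u v))]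
    have h5 : ∀ z, ∫ s, (D (z, s) v u - D (z, s) u v) ∂(volume.restrict (Ioc 0 1)) =
        η x u v - η (g z 1 x) (g z 1 u) (g z 1 v) := fun z => by
      rw [← neg_sub (η (g z 1 x) (g z 1 u) (g z 1 v)), ← hslice z, ← integral_neg]
      simp only [neg_sub]
    simp only [h5]
    rw [integral_sub (integrable_const _) hbd, hkill x hx0]
    simp
  · intro x B hB
    have hle : ∀ᵐ θ ∂μ, ‖homotopyIntegrand η (m θ, x)‖ ≤ C ^ 2 * (‖x‖ * B) := by
      filter_upwards [hae] with θ hθ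
      rw [show θ = (θ.1, θ.2) from rfl, hmeq _ _ hθ]
      have h1 := hB _ (hgκ θ.1 θ.2 hθ x)
      have hB0 : 0 ≤ B := (norm_nonneg (η (g θ.1 θ.2 x))).trans h1
      calc _ ≤ ‖η (g θ.1 θ.2 x) (g' θ.1 θ.2 x)‖ * ‖g θ.1 θ.2‖ :=
            ContinuousLinearMap.opNorm_comp_le _ _
        _ ≤ (B * (C * ‖x‖)) * C := by
            refine mul_le_mul ?_ (hgC _ _ hθ) (norm_nonneg _) (by positivity)
            exact ContinuousLinearMap.le_of_opNorm_le_of_le _ h1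
              (ContinuousLinearMap.le_of_opNorm_le _ (hgC' _ _ hθ) x)
        _ = _ := by ring
    have := norm_integral_le_of_norm_le_const hle
    rw [hμ, mul_one] at this
    rwa [norm_neg]
  · intro x B B' hB hB'
    have hle : ∀ᵐ θ ∂μ, ‖(fderiv ℝ (homotopyIntegrand η) (m θ, x)).comp
        (ContinuousLinearMap.inr ℝ ((E →L[ℝ] E) × (E →L[ℝ] E)) E)‖ ≤
        C ^ 3 * (‖x‖ * B') + C ^ 2 * B := by
      filter_upwards [hae] with θ hθ
      rw [show θ = (θ.1, θ.2) from rfl, hmeq _ _ hθ]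
      have h1 := hB _ (hgκ θ.1 θ.2 hθ x)
      have h1' := hB' _ (hgκ θ.1 θ.2 hθ x)
      have hB0 : 0 ≤ B := (norm_nonneg (η (g θ.1 θ.2 x))).trans h1
      have hB0' : 0 ≤ B' := (norm_nonneg (fderiv ℝ η (g θ.1 θ.2 x))).trans h1'
      have hA : ∀ w, ‖g θ.1 θ.2 w‖ ≤ C * ‖w‖ := fun w =>
        ContinuousLinearMap.le_of_opNorm_le _ (hgC _ _ hθ) w
      have hA' : ∀ w, ‖g' θ.1 θ.2 w‖ ≤ C * ‖w‖ := fun w =>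
        ContinuousLinearMap.le_of_opNorm_le _ (hgC' _ _ hθ) w
      refine ContinuousLinearMap.opNorm_le_bound₂ _ (by positivity) fun u v => ?_
      rw [fderiv_homotopyIntegrand hη1]
      calc _ ≤ ‖fderiv ℝ η (g θ.1 θ.2 x) (g θ.1 θ.2 u) (g' θ.1 θ.2 x) (g θ.1 θ.2 v)‖ +
            ‖η (g θ.1 θ.2 x) (g' θ.1 θ.2 u) (g θ.1 θ.2 v)‖ := norm_add_le _ _
        _ ≤ (B' * (C * ‖u‖)) * (C * ‖x‖) * (C * ‖v‖) + B * (C * ‖u‖) * (C * ‖v‖) := by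
            gcongr
            · exact ContinuousLinearMap.le_of_opNorm_le_of_le _
                (ContinuousLinearMap.le_of_opNorm_le_of_le _
                  (ContinuousLinearMap.le_of_opNorm_le_of_le _ h1' (hA u)) (hA' x)) (hA v)
            · exact ContinuousLinearMap.le_of_opNorm_le_of_le _
                (ContinuousLinearMap.le_of_opNorm_le_of_le _ h1 (hA' u)) (hA v)
        _ = _ := by ring
    have := norm_integral_le_of_norm_le_const hle
    rw [hμ, mul_one] at this
    rwa [hfd, norm_neg]

end Primitive

/-! ### A random path of rotations that annihilates two-forms on average -/

section Quaternionic

open MeasureTheory Quaternion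

set_option maxSynthPendingDepth 3

/-- The identification of the quaternions with `ℝ⁴`. -/
noncomputable def quatEquiv : ℍ ≃ₗᵢ[ℝ] R4 := Quaternion.linearIsometryEquivTuple

/-- The linear map `x ↦ a x b` of `ℝ⁴`, identified with the quaternions. -/
noncomputable def sandwich : ℍ →L[ℝ] ℍ →L[ℝ] R4 →L[ℝ] R4 :=
  LinearMap.mkContinuous₂
    (LinearMap.mk₂ ℝ (fun a b : ℍ => (quatEquiv.toContinuousLinearEquiv : ℍ →L[ℝ] R4).comp
        ((ContinuousLinearMap.mulLeftRight ℝ ℍ a b).comp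
          (quatEquiv.symm.toContinuousLinearEquiv : R4 →L[ℝ] ℍ)))
      (fun _ _ _ => by ext1; simp) (fun _ _ _ => by ext1; simp)
      (fun _ _ _ => by ext1; simp) (fun _ _ _ => by ext1; simp)) 1 (by
    intro a b
    refine ContinuousLinearMap.opNorm_le_bound _ (by positivity) fun x => le_of_eq ?_
    simp [norm_mul]
    ring)

theorem sandwich_apply (a b : ℍ) (x : R4) :
    sandwich a b x = quatEquiv (a * quatEquiv.symm x * b) := rfl

theorem norm_sandwich_apply (a b : ℍ) (x : R4) :
    ‖sandwich a b x‖ = ‖a‖ * ‖b‖ * ‖x‖ := by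
  rw [sandwich_apply]
  simp [norm_mul]
  ring

theorem norm_sandwich_le (a b : ℍ) : ‖sandwich a b‖ ≤ ‖a‖ * ‖b‖ :=
  ContinuousLinearMap.opNorm_le_bound _ (by positivity) fun x => (norm_sandwich_apply a b x).le

theorem Quaternion.sq_norm_eq (a : ℍ) :
    ‖a‖ ^ 2 = a.re ^ 2 + a.imI ^ 2 + a.imJ ^ 2 + a.imK ^ 2 := by
  rw [sq, ← Quaternion.normSq_eq_norm_mul_self, Quaternion.normSq_def']

/-- The quaternion units `1, i, j, k`. -/
def quatUnit : Fin 4 → ℍ := ![1, ⟨0, 1, 0, 0⟩, ⟨0, 0, 1, 0⟩, ⟨0, 0, 0, 1⟩]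

theorem re_quatUnit (i : Fin 4) : (quatUnit i).re = (![1, 0, 0, 0] : Fin 4 → ℝ) i := by
  fin_cases i <;> rfl

theorem imI_quatUnit (i : Fin 4) : (quatUnit i).imI = (![0, 1, 0, 0] : Fin 4 → ℝ) i := by
  fin_cases i <;> rfl

theorem imJ_quatUnit (i : Fin 4) : (quatUnit i).imJ = (![0, 0, 1, 0] : Fin 4 → ℝ) i := by
  fin_cases i <;> rfl

theorem imK_quatUnit (i : Fin 4) : (quatUnit i).imK = (![0, 0, 0, 1] : Fin 4 → ℝ) i := by
  fin_cases i <;> rfl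

theorem norm_quatUnit (i : Fin 4) : ‖quatUnit i‖ = 1 := by
  have : ‖quatUnit i‖ ^ 2 = 1 := by
    rw [Quaternion.sq_norm_eq, re_quatUnit, imI_quatUnit, imJ_quatUnit, imK_quatUnit]
    fin_cases i <;> simp
  nlinarith [norm_nonneg (quatUnit i)]

theorem re_quatUnit_nonneg (i : Fin 4) : 0 ≤ (quatUnit i).re := by
  rw [re_quatUnit]
  fin_cases i <;> simp

theorem quatUnit_inv (i : Fin 4) : (quatUnit i)⁻¹ = star (quatUnit i) := by
  refine inv_eq_of_mul_eq_one_right ?_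
  ext <;> simp [re_quatUnit, imI_quatUnit, imJ_quatUnit, imK_quatUnit] <;> fin_cases i <;> simp

theorem eq_sum_quatUnit (u : ℍ) : u = ∑ a, (![u.re, u.imI, u.imJ, u.imK] a) • quatUnit a := by
  ext <;> simp [Fin.sum_univ_four, re_quatUnit, imI_quatUnit, imJ_quatUnit, imK_quatUnit]

/-- A measurable choice of a square root, with non-negative real part, of the direction of a
quaternion. -/
theorem exists_measurable_sqrt_direction : ∃ p : R4 → R4, Measurable p ∧ (∀ y, ‖p y‖ = 1) ∧
    (∀ y, 0 ≤ (quatEquiv.symm (p y)).re) ∧ ∀ y, y ≠ 0 →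
      quatEquiv.symm (p y) * quatEquiv.symm (p y) = ‖y‖⁻¹ • quatEquiv.symm y := by
  classical
  let w : R4 → R4 := fun y => ‖y‖ • quatEquiv 1 + y
  have hw : Continuous w := by fun_prop
  -- the root of `q = y / ‖y‖` is `(1 + q) / ‖1 + q‖`, unless `q = -1`, where `i` is taken
  refine ⟨fun y => if w y = 0 then quatEquiv (quatUnit 1) else ‖w y‖⁻¹ • w y, ?_, fun y => ?_,
    fun y => ?_, fun y hy => ?_⟩
  · refine Measurable.ite (measurableSet_eq_fun hw.measurable measurable_const)
      measurable_const ?_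
    exact hw.measurable.norm.inv.smul hw.measurable
  · by_cases h : w y = 0
    · simp [h, norm_quatUnit]
    · simp [h, norm_smul]
  · by_cases h : w y = 0
    · simp [h, re_quatUnit_nonneg]
    · simp only [h, if_false]
      have h1 : -‖y‖ ≤ (quatEquiv.symm y).re := by
        have h2 := Quaternion.sq_norm_eq (quatEquiv.symm y)
        rw [LinearIsometryEquiv.norm_map] at h2
        have h3 : (quatEquiv.symm y).re ^ 2 ≤ ‖y‖ ^ 2 := by
          rw [h2, add_assoc, add_assoc]
          exact le_add_of_nonneg_right (by positivity)
        exact neg_le_of_abs_le (abs_le_of_sq_le_sq h3 (norm_nonneg _))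
      simp only [map_smul, w, map_add, LinearIsometryEquiv.symm_apply_apply]
      have h3 : 0 ≤ ‖y‖ + (quatEquiv.symm y).re := by linarith
      simp only [Quaternion.re_smul, Quaternion.re_add, Quaternion.re_one, smul_eq_mul, mul_one]
      positivity
  · have hz := Quaternion.sq_norm_eq (quatEquiv.symm y)
    rw [LinearIsometryEquiv.norm_map] at hz
    have hwz : quatEquiv.symm (w y) = ‖y‖ • 1 + quatEquiv.symm y := by simp [w]
    have hwn := Quaternion.sq_norm_eq (quatEquiv.symm (w y))
    rw [LinearIsometryEquiv.norm_map, hwz] at hwn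
    have hy0 : ‖y‖ ≠ 0 := norm_ne_zero_iff.2 hy
    by_cases h : w y = 0
    · simp only [h, if_true, LinearIsometryEquiv.symm_apply_apply]
      have hzy : quatEquiv.symm y = -(‖y‖ • 1) := by
        have := hwz
        rw [h, map_zero] at this
        exact (neg_eq_of_add_eq_zero_right this.symm).symm
      rw [hzy, smul_neg, smul_smul, inv_mul_cancel₀ hy0, one_smul]
      ext <;> simp [re_quatUnit, imI_quatUnit, imJ_quatUnit, imK_quatUnit]
    · simp only [h, if_false, map_smul]
      have hw0 : ‖w y‖ ≠ 0 := norm_ne_zero_iff.2 h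
      rw [smul_mul_smul_comm]
      rw [hwz]
      set z := quatEquiv.symm y
      simp only [Quaternion.re_smul, Quaternion.re_add, Quaternion.re_one, Quaternion.imI_add,
        Quaternion.imI_smul, Quaternion.imI_one, Quaternion.imJ_add, Quaternion.imJ_smul,
        Quaternion.imJ_one, Quaternion.imK_add, Quaternion.imK_smul, Quaternion.imK_one,
        smul_eq_mul, mul_one, mul_zero, zero_add] at hwn
      have hwn2 : ‖w y‖ ^ 2 = 2 * ‖y‖ * (‖y‖ + z.re) := by rw [hwn]; nlinarith
      have key : ((‖y‖ • (1 : ℍ) + z) * (‖y‖ • 1 + z)) = (2 * (‖y‖ + z.re)) • z := by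
        ext <;> simp <;> nlinarith
      rw [key, smul_smul]
      congr 1
      have h5 : ‖w y‖⁻¹ * ‖w y‖⁻¹ = (‖w y‖ ^ 2)⁻¹ := by rw [sq, mul_inv]
      have h6 : ‖y‖ + z.re ≠ 0 := by
        intro h0
        rw [h0, mul_zero] at hwn2
        exact hw0 (by simpa using hwn2)
      rw [h5, hwn2]
      field_simp

/-- The character table of the Klein four-group. -/
def kleinSign : Fin 4 → Fin 4 → ℝ :=
  ![![1, 1, 1, 1], ![1, 1, -1, -1], ![1, -1, 1, -1], ![1, -1, -1, 1]]

/-- The conjugations by `1, i, j, k` act on `1, i, j, k` diagonally, through the four characters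
of the Klein four-group. -/
theorem conj_quatUnit (i a : Fin 4) : (quatUnit i)⁻¹ * quatUnit a * quatUnit i =
    kleinSign i a • quatUnit a := by
  rw [quatUnit_inv]
  ext <;> simp [re_quatUnit, imI_quatUnit, imJ_quatUnit, imK_quatUnit] <;>
    fin_cases i <;> fin_cases a <;> simp [kleinSign]

/-- Averaging over the conjugations by `1, i, j, k` annihilates alternating forms: by
orthogonality of characters only the diagonal entries survive. -/
theorem sum_conj_quatUnit_eq_zero (B : ℍ →ₗ[ℝ] ℍ →ₗ[ℝ] ℝ) (hB : ∀ u, B u u = 0) (u v : ℍ) :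
    ∑ i, B ((quatUnit i)⁻¹ * u * quatUnit i) ((quatUnit i)⁻¹ * v * quatUnit i) = 0 := by
  set c : ℍ → Fin 4 → ℝ := fun u => ![u.re, u.imI, u.imJ, u.imK] with hc
  have hconj : ∀ (i : Fin 4) (u : ℍ), (quatUnit i)⁻¹ * u * quatUnit i =
      ∑ a, (c u a * kleinSign i a) • quatUnit a := fun i u => by
    conv_lhs => rw [eq_sum_quatUnit u]
    simp only [Finset.mul_sum, Finset.sum_mul, mul_smul_comm, smul_mul_assoc, conj_quatUnit,
      smul_smul, hc]
  have horth : ∀ a b, a ≠ b → ∑ i, kleinSign i a * kleinSign i b = 0 := fun a b => by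
    fin_cases a <;> fin_cases b <;> simp [kleinSign, Fin.sum_univ_four]
  have hexp : ∀ i, B ((quatUnit i)⁻¹ * u * quatUnit i) ((quatUnit i)⁻¹ * v * quatUnit i) =
      ∑ a, ∑ b, c u a * c v b * B (quatUnit a) (quatUnit b) *
        (kleinSign i a * kleinSign i b) := fun i => by
    rw [hconj, hconj]
    simp only [map_sum, LinearMap.sum_apply, map_smul, LinearMap.smul_apply, smul_eq_mul,
      Finset.mul_sum]
    rw [Finset.sum_comm]
    exact Finset.sum_congr rfl fun a _ => Finset.sum_congr rfl fun b _ => by ring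
  simp only [hexp]
  rw [Finset.sum_comm]
  refine Finset.sum_eq_zero fun a _ => ?_
  rw [Finset.sum_comm]
  refine Finset.sum_eq_zero fun b _ => ?_
  rw [← Finset.mul_sum]
  by_cases hab : a = b
  · rw [hab, hB]; ring
  · rw [horth a b hab, mul_zero]

theorem norm_sq_segment_one (p : ℍ) (hp : ‖p‖ = 1) (s : ℝ) :
    ‖1 + s • (p - 1)‖ ^ 2 = (1 - s) ^ 2 + 2 * s * (1 - s) * p.re + s ^ 2 := by
  have h1 := Quaternion.sq_norm_eq p
  rw [hp] at h1
  rw [Quaternion.sq_norm_eq]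
  simp
  nlinarith

theorem half_le_norm_segment_one {p : ℍ} (hp : ‖p‖ = 1) (hre : 0 ≤ p.re) {s : ℝ}
    (hs : s ∈ Icc (0 : ℝ) 1) : 1 / 2 ≤ ‖1 + s • (p - 1)‖ ^ 2 := by
  have h2 : 0 ≤ 2 * s * (1 - s) * p.re :=
    mul_nonneg (mul_nonneg (by linarith [hs.1]) (by linarith [hs.2])) hre
  rw [norm_sq_segment_one p hp]
  nlinarith [sq_nonneg (2 * s - 1)]

theorem norm_segment_one_le {p : ℍ} (hp : ‖p‖ = 1) {s : ℝ}
    (hs : s ∈ Icc (0 : ℝ) 1) : ‖1 + s • (p - 1)‖ ≤ 1 := by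
  have : 1 + s • (p - 1) = (1 - s) • (1 : ℍ) + s • p := by
    rw [smul_sub, sub_smul, one_smul]; abel
  rw [this]
  refine (norm_add_le _ _).trans ?_
  rw [norm_smul, norm_smul, hp, norm_one, Real.norm_of_nonneg hs.1,
    Real.norm_of_nonneg (by linarith [hs.2])]
  linarith

/-- The path `s ↦ (x ↦ (1 + s (p - 1))² x (1 + s (n - 1)))` from the identity to
`x ↦ p² x n`. The square keeps it away from `0` even when `p²` is close to `-1`: a straight line
from `1` to `p²` could pass through `0`, the line from `1` to `p` does not if `re p ≥ 0`. -/
noncomputable def rotationPath (p n : ℍ) (s : ℝ) : R4 →L[ℝ] R4 :=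
  sandwich ((1 + s • (p - 1)) * (1 + s • (p - 1))) (1 + s • (n - 1))

/-- The velocity of `rotationPath`. -/
noncomputable def rotationVelocity (p n : ℍ) (s : ℝ) : R4 →L[ℝ] R4 :=
  sandwich ((p - 1) * (1 + s • (p - 1)) + (1 + s • (p - 1)) * (p - 1)) (1 + s • (n - 1)) +
    sandwich ((1 + s • (p - 1)) * (1 + s • (p - 1))) (n - 1)

theorem hasDerivAt_rotationPath (p n : ℍ) (s : ℝ) :
    HasDerivAt (rotationPath p n) (rotationVelocity p n s) s := by
  have h1 : ∀ q : ℍ, HasDerivAt (fun s : ℝ => 1 + s • (q - 1)) (q - 1) s := fun q => by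
    simpa using ((hasDerivAt_id s).smul_const (q - 1)).const_add 1
  have h2 := (h1 p).mul (h1 p)
  have h3 := sandwich.hasFDerivAt.comp_hasDerivAt s h2
  exact h3.clm_apply (h1 n)

theorem rotationPath_zero (p n : ℍ) : rotationPath p n 0 = ContinuousLinearMap.id ℝ R4 := by
  ext1 x
  simp [rotationPath, sandwich_apply]

theorem rotationPath_one_apply (p n : ℍ) (x : R4) :
    rotationPath p n 1 x = quatEquiv (p * p * quatEquiv.symm x * n) := by
  simp [rotationPath, sandwich_apply]

theorem continuous_rotationPath (n : ℍ) :
    Continuous fun z : ℝ × R4 => rotationPath (quatEquiv.symm z.2) n z.1 := by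
  unfold rotationPath
  fun_prop

theorem continuous_rotationVelocity (n : ℍ) :
    Continuous fun z : ℝ × R4 => rotationVelocity (quatEquiv.symm z.2) n z.1 := by
  unfold rotationVelocity
  fun_prop

theorem continuous_rotationVelocity_time (p n : ℍ) : Continuous (rotationVelocity p n) := by
  unfold rotationVelocity
  fun_prop

section Bounds

variable {p n : ℍ} (hp : ‖p‖ = 1) (hn : ‖n‖ = 1) {s : ℝ} (hs : s ∈ Icc (0 : ℝ) 1)
include hp hn hs

theorem norm_rotationPath_le : ‖rotationPath p n s‖ ≤ 1 := by
  refine (norm_sandwich_le _ _).trans ?_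
  rw [norm_mul]
  have h1 := norm_segment_one_le hp hs
  have h2 := norm_segment_one_le hn hs
  exact mul_le_one₀ (mul_le_one₀ h1 (norm_nonneg _) h1) (norm_nonneg _) h2

theorem norm_rotationVelocity_le : ‖rotationVelocity p n s‖ ≤ 6 := by
  have h1 := norm_segment_one_le hp hs
  have h2 := norm_segment_one_le hn hs
  have h3 : ∀ q : ℍ, ‖q‖ = 1 → ‖q - 1‖ ≤ 2 := fun q hq => by
    refine (norm_sub_le _ _).trans ?_
    rw [hq, norm_one]; norm_num
  refine (norm_add_le _ _).trans ?_
  have h4 : ‖(p - 1) * (1 + s • (p - 1)) + (1 + s • (p - 1)) * (p - 1)‖ ≤ 4 := by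
    refine (norm_add_le _ _).trans ?_
    rw [norm_mul, norm_mul]
    nlinarith [h3 p hp, norm_nonneg (p - 1), norm_nonneg (1 + s • (p - 1))]
  have h5 : ‖(1 + s • (p - 1)) * (1 + s • (p - 1))‖ ≤ 1 := by
    rw [norm_mul]; exact mul_le_one₀ h1 (norm_nonneg _) h1
  have h6 := mul_le_mul h4 h2 (norm_nonneg _) (by norm_num)
  have h7 := mul_le_mul h5 (h3 n hn) (norm_nonneg _) (by norm_num)
  linarith [norm_sandwich_le ((p - 1) * (1 + s • (p - 1)) + (1 + s • (p - 1)) * (p - 1))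
    (1 + s • (n - 1)), norm_sandwich_le ((1 + s • (p - 1)) * (1 + s • (p - 1))) (n - 1)]

theorem le_norm_rotationPath_apply (hpr : 0 ≤ p.re) (hnr : 0 ≤ n.re) (x : R4) :
    1 / 4 * ‖x‖ ≤ ‖rotationPath p n s x‖ := by
  rw [rotationPath, norm_sandwich_apply, norm_mul, ← sq]
  have h1 := half_le_norm_segment_one hp hpr hs
  have h2 := half_le_norm_segment_one hn hnr hs
  have h3 : 1 / 2 ≤ ‖1 + s • (n - 1)‖ := by
    nlinarith [norm_nonneg (1 + s • (n - 1))]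
  refine mul_le_mul_of_nonneg_right ?_ (norm_nonneg _)
  nlinarith

end Bounds
end Quaternionic

/-! ### Primitives of two-forms near infinity -/

section ExistsPrimitive

open MeasureTheory Quaternion

set_option maxSynthPendingDepth 3

/-- Right multiplication by a unit quaternion, as a linear isometry of `ℝ⁴`. -/
noncomputable def rightMulIsometry (c : ℍ) (hc : ‖c‖ = 1) : R4 ≃ₗᵢ[ℝ] R4 :=
  LinearIsometry.toLinearIsometryEquiv
    { toLinearMap := (sandwich 1 c : R4 →L[ℝ] R4)
      norm_map' := fun x => by
        change ‖sandwich 1 c x‖ = ‖x‖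
        rw [norm_sandwich_apply, hc, norm_one, one_mul, one_mul] } rfl

theorem rightMulIsometry_apply (c : ℍ) (hc : ‖c‖ = 1) (x : R4) :
    quatEquiv.symm (rightMulIsometry c hc x) = quatEquiv.symm x * c := by
  change quatEquiv.symm (sandwich 1 c x) = _
  rw [sandwich_apply, LinearIsometryEquiv.symm_apply_apply, one_mul]

theorem integral_ball_comp_isometry (T : R4 ≃ₗᵢ[ℝ] R4) (f : R4 → ℝ) :
    ∫ y in Metric.ball 0 1, f (T y) = ∫ y in Metric.ball 0 1, f y := by
  have h := T.measurePreserving.setIntegral_preimage_emb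
    T.toHomeomorph.measurableEmbedding f (Metric.ball 0 1)
  have h2 : T ⁻¹' Metric.ball 0 1 = Metric.ball 0 1 := by
    ext y; simp
  rwa [h2] at h

/-- The uniform average of `(x ↦ q x n)^*η` over unit quaternions `q` and `n ∈ {1, i, j, k}`
vanishes: after right translation of `q`, the average over `n` of the value at a point becomes
an average of conjugations by `1, i, j, k`. -/
theorem sum_integral_sandwich_eq_zero {η : R4 → R4 →L[ℝ] R4 →L[ℝ] ℝ}
    (hη : Continuous η) (halt : ∀ x v, η x v v = 0) {x : R4} (hx : x ≠ 0) (u v : R4) :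
    ∑ i, ∫ y in Metric.ball (0 : R4) 1,
      η (sandwich (‖y‖⁻¹ • quatEquiv.symm y) (quatUnit i) x)
        (sandwich (‖y‖⁻¹ • quatEquiv.symm y) (quatUnit i) u)
        (sandwich (‖y‖⁻¹ • quatEquiv.symm y) (quatUnit i) v) = 0 := by
  set X := quatEquiv.symm x with hX
  have hX0 : X ≠ 0 := by simpa [hX] using hx
  have hn0 : ∀ i, quatUnit i ≠ 0 := fun i => norm_ne_zero_iff.1 (by simp [norm_quatUnit])
  have hc : ∀ i, ‖X * (quatUnit i)⁻¹ * X⁻¹‖ = 1 := fun i => by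
    rw [norm_mul, norm_mul, norm_inv, norm_inv, norm_quatUnit, inv_one, mul_one,
      mul_inv_cancel₀ (norm_ne_zero_iff.2 hX0)]
  let q : R4 → ℍ := fun y => ‖y‖⁻¹ • quatEquiv.symm y
  have hqm : ∀ y, ‖y‖⁻¹ • quatEquiv.symm y = quatEquiv.symm (‖y‖⁻¹ • y) := fun y => by simp
  have hsub : ∀ (i : Fin 4) (y w : R4),
      sandwich (‖rightMulIsometry _ (hc i) y‖⁻¹ •
        quatEquiv.symm (rightMulIsometry _ (hc i) y)) (quatUnit i) w =
      quatEquiv (q y * X * ((quatUnit i)⁻¹ * (X⁻¹ * quatEquiv.symm w) * quatUnit i)) :=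
    fun i y w => by
      rw [LinearIsometryEquiv.norm_map, rightMulIsometry_apply, sandwich_apply]
      simp only [q, smul_mul_assoc, mul_assoc]
  have hx' : ∀ i y, q y * X * ((quatUnit i)⁻¹ * (X⁻¹ * X) * quatUnit i) = q y * X := fun i y => by
    rw [inv_mul_cancel₀ hX0, mul_one, inv_mul_cancel₀ (hn0 i), mul_one]
  let F : Fin 4 → R4 → ℝ := fun i y =>
    η (quatEquiv (q y * X))
      (quatEquiv (q y * X * ((quatUnit i)⁻¹ * (X⁻¹ * quatEquiv.symm u) * quatUnit i)))
      (quatEquiv (q y * X * ((quatUnit i)⁻¹ * (X⁻¹ * quatEquiv.symm v) * quatUnit i)))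
  have hF : ∀ i, ∫ y in Metric.ball (0 : R4) 1,
      η (sandwich (‖y‖⁻¹ • quatEquiv.symm y) (quatUnit i) x)
        (sandwich (‖y‖⁻¹ • quatEquiv.symm y) (quatUnit i) u)
        (sandwich (‖y‖⁻¹ • quatEquiv.symm y) (quatUnit i) v) =
      ∫ y in Metric.ball (0 : R4) 1, F i y := fun i => by
    rw [← integral_ball_comp_isometry (rightMulIsometry _ (hc i))]
    refine integral_congr_ae (Eventually.of_forall fun y => ?_)
    simp only [hsub, F]
    rw [← hX, hx']
  have hm : Measurable fun y : R4 => ‖y‖⁻¹ • y := measurable_norm.inv.smul measurable_id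
  have hb : ∀ y : R4, ‖‖y‖⁻¹ • y‖ ≤ 1 := fun y => by
    rw [norm_smul, norm_inv, norm_norm]
    exact inv_mul_le_one
  have hint : ∀ i, Integrable (F i) (volume.restrict (Metric.ball (0 : R4) 1)) := fun i => by
    have hfin : IsFiniteMeasure (volume.restrict (Metric.ball (0 : R4) 1)) :=
      isFiniteMeasure_restrict.2 measure_ball_lt_top.ne
    have := integrable_comp_of_bounded
      (μ := volume.restrict (Metric.ball (0 : R4) 1)) hm hb (φ := fun y =>
      η (quatEquiv (quatEquiv.symm y * X))
        (quatEquiv (quatEquiv.symm y * X *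
          ((quatUnit i)⁻¹ * (X⁻¹ * quatEquiv.symm u) * quatUnit i)))
        (quatEquiv (quatEquiv.symm y * X *
          ((quatUnit i)⁻¹ * (X⁻¹ * quatEquiv.symm v) * quatUnit i))))
        (((hη.comp (by fun_prop)).clm_apply (by fun_prop)).clm_apply (by fun_prop))
    simpa only [F, q, hqm] using this
  simp only [hF]
  rw [← integral_finsetSum _ fun i _ => hint i]
  refine integral_eq_zero_of_ae (Eventually.of_forall fun y => ?_)
  let A : ℍ →ₗ[ℝ] R4 := quatEquiv.toLinearEquiv.toLinearMap ∘ₗ LinearMap.mulLeft ℝ (q y * X)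
  let B : ℍ →ₗ[ℝ] ℍ →ₗ[ℝ] ℝ :=
    LinearMap.mk₂ ℝ (fun a b => η (quatEquiv (q y * X)) (A a) (A b))
      (fun _ _ _ => by simp) (fun _ _ _ => by simp) (fun _ _ _ => by simp) (fun _ _ _ => by simp)
  exact sum_conj_quatUnit_eq_zero B (fun w => halt _ _) (X⁻¹ * quatEquiv.symm u)
    (X⁻¹ * quatEquiv.symm v)

-- keeps unification from unfolding the quaternionic formulas
attribute [local irreducible] rotationPath rotationVelocity

/-- A two-form of class `C²` on `ℝ⁴` that is closed near infinity has, near infinity, a primitive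
of class `C²`, bounded by `‖x‖` times the form, and with derivative bounded by the form and
`‖x‖` times its derivative. -/
theorem exists_primitive {η : R4 → R4 →L[ℝ] R4 →L[ℝ] ℝ} (hη : ContDiff ℝ 2 η)
    (halt : ∀ x v, η x v v = 0) {r : ℝ} (hcl : ∀ x, r ≤ ‖x‖ → IsClosedFormAt η x) :
    ∃ α : R4 → R4 →L[ℝ] ℝ, ContDiff ℝ 2 α ∧
      (∀ x, x ≠ 0 → r ≤ 1 / 4 * ‖x‖ →
        ∀ u v, fderiv ℝ α x u v - fderiv ℝ α x v u = η x u v) ∧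
      (∀ x B, (∀ y, 1 / 4 * ‖x‖ ≤ ‖y‖ → ‖η y‖ ≤ B) → ‖α x‖ ≤ 6 ^ 2 * (‖x‖ * B)) ∧
      (∀ x B B', (∀ y, 1 / 4 * ‖x‖ ≤ ‖y‖ → ‖η y‖ ≤ B) →
        (∀ y, 1 / 4 * ‖x‖ ≤ ‖y‖ → ‖fderiv ℝ η y‖ ≤ B') →
        ‖fderiv ℝ α x‖ ≤ 6 ^ 3 * (‖x‖ * B') + 6 ^ 2 * B) := by
  obtain ⟨p, hpm, hp1, hpre, hpsq⟩ := exists_measurable_sqrt_direction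
  have hball : volume (Metric.ball (0 : R4) 1) ≠ 0 := (Metric.measure_ball_pos _ _ one_pos).ne'
  have hball' : volume (Metric.ball (0 : R4) 1) ≠ ⊤ := measure_ball_lt_top.ne
  have hfin : IsFiniteMeasure (volume.restrict (Metric.ball (0 : R4) 1)) :=
    isFiniteMeasure_restrict.2 hball'
  let V := volume (Metric.ball (0 : R4) 1)
  -- a uniform point of the unit ball and an independent uniform quaternion unit
  let ν : Measure (R4 × Fin 4) := (V * 4)⁻¹ •
    (volume.restrict (Metric.ball (0 : R4) 1)).prod Measure.count
  have hν : IsProbabilityMeasure ν := ⟨by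
    have h1 : ((volume.restrict (Metric.ball (0 : R4) 1)).prod
        (Measure.count : Measure (Fin 4))) univ = V * 4 := by
      rw [← univ_prod_univ, Measure.prod_prod]
      simp [V, Measure.count_apply]
    simp only [ν, Measure.smul_apply, h1, smul_eq_mul]
    exact ENNReal.inv_mul_cancel (by simp [V, hball]) (ENNReal.mul_ne_top hball' (by simp))⟩
  have hp1' : ∀ y, ‖quatEquiv.symm (p y)‖ = 1 := fun y => by simp [hp1]
  have hmeas : ∀ f : Fin 4 → ℝ × R4 → R4 →L[ℝ] R4, (∀ i, Continuous (f i)) →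
      Measurable fun θ : (R4 × Fin 4) × ℝ => f θ.1.2 (θ.2, p θ.1.1) := fun f hf => by
    have h1 : Measurable fun θ : (ℝ × R4) × Fin 4 => f θ.2 θ.1 :=
      measurable_from_prod_countable_left fun i => (hf i).measurable
    exact h1.comp ((measurable_snd.prodMk (hpm.comp (measurable_fst.comp measurable_fst))).prodMk
      (measurable_snd.comp measurable_fst))
  let g : R4 × Fin 4 → ℝ → R4 →L[ℝ] R4 :=
    fun z => rotationPath (quatEquiv.symm (p z.1)) (quatUnit z.2)
  let g' : R4 × Fin 4 → ℝ → R4 →L[ℝ] R4 :=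
    fun z => rotationVelocity (quatEquiv.symm (p z.1)) (quatUnit z.2)
  have hgm : Measurable fun θ : (R4 × Fin 4) × ℝ => g θ.1 θ.2 :=
    hmeas (fun i z => rotationPath (quatEquiv.symm z.2) (quatUnit i) z.1)
      fun i => continuous_rotationPath (quatUnit i)
  have hgm' : Measurable fun θ : (R4 × Fin 4) × ℝ => g' θ.1 θ.2 :=
    hmeas (fun i z => rotationVelocity (quatEquiv.symm z.2) (quatUnit i) z.1)
      fun i => continuous_rotationVelocity (quatUnit i)
  have hg1 : ∀ z, ∀ s ∈ Icc (0 : ℝ) 1, ‖g z s‖ ≤ 1 := fun z s hs =>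
    norm_rotationPath_le (hp1' _) (norm_quatUnit _) hs
  have hg6 : ∀ z, ∀ s ∈ Icc (0 : ℝ) 1, ‖g z s‖ ≤ 6 := fun z s hs =>
    (hg1 z s hs).trans (by norm_num)
  have hg6' : ∀ z, ∀ s ∈ Icc (0 : ℝ) 1, ‖g' z s‖ ≤ 6 := fun z s hs =>
    norm_rotationVelocity_le (hp1' _) (norm_quatUnit _) hs
  have hgκ : ∀ z, ∀ s ∈ Icc (0 : ℝ) 1, ∀ x, 1 / 4 * ‖x‖ ≤ ‖g z s x‖ := fun z s hs x =>
    le_norm_rotationPath_apply (hp1' _) (norm_quatUnit _) hs (hpre _) (re_quatUnit_nonneg _) x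
  have hgd : ∀ z s, HasDerivAt (g z) (g' z s) s := fun z s => hasDerivAt_rotationPath _ _ s
  have hgc : ∀ z, Continuous (g' z) := fun z => continuous_rotationVelocity_time _ _
  have hg0 : ∀ z, g z 0 = ContinuousLinearMap.id ℝ R4 := fun z => rotationPath_zero _ _
  refine exists_primitive_of_random_homotopy ν hgm hgm' hg6 hg6' hgκ hgd hgc hg0 hη halt
    (fun x hx u v => ?_) hcl
  simp only [ν]
  rw [integral_smul_measure]
  refine smul_eq_zero_of_right _ ?_
  have hint : Integrable (fun z => η (g z 1 x) (g z 1 u) (g z 1 v))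
      ((volume.restrict (Metric.ball (0 : R4) 1)).prod Measure.count) := by
    have hm1 : Measurable fun z => g z 1 := hgm.comp (measurable_id.prodMk measurable_const)
    refine integrable_comp_of_bounded (m := fun z => g z 1) hm1 (fun z => hg1 z 1 (by simp))
      (φ := fun A => η (A x) (A u) (A v)) ?_
    have hap : ∀ w : R4, Continuous fun A : R4 →L[ℝ] R4 => A w := fun w => by fun_prop
    exact ((hη.continuous.comp (hap x)).clm_apply (hap u)).clm_apply (hap v)
  -- at `s = 1` the path `z = (y, i)` is `x ↦ (y / ‖y‖) x n` with `n` the `i`-th quaternion unit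
  rw [integral_prod_symm _ hint, integral_count,
    ← sum_integral_sandwich_eq_zero hη.continuous halt hx u v]
  refine Finset.sum_congr rfl fun i _ => ?_
  refine integral_congr_ae ?_
  have h0 : ∀ᵐ y ∂(volume.restrict (Metric.ball (0 : R4) 1)), y ≠ 0 :=
    ae_restrict_of_ae (by simp [ae_iff])
  filter_upwards [h0] with y hy
  simp only [g, rotationPath_one_apply, hpsq y hy, sandwich_apply]

end ExistsPrimitive

/-! ### Radial cut-off functions -/

section Cutoff

set_option maxSynthPendingDepth 3

/-- A smooth radial function that vanishes for `‖x‖ ≤ 1` and equals `1` for `‖x‖ ≥ 2`. -/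
noncomputable def unitCutoff (x : R4) : ℝ := Real.smoothTransition (‖x‖ ^ 2 - 1)

/-- The rescaled cut-off function, which vanishes for `‖x‖ ≤ ρ` and equals `1` for
`‖x‖ ≥ 2 ρ`. -/
noncomputable def cutoff (ρ : ℝ) (x : R4) : ℝ := unitCutoff (ρ⁻¹ • x)

theorem contDiff_unitCutoff {n : ℕ∞} : ContDiff ℝ n unitCutoff :=
  Real.smoothTransition.contDiff.comp ((contDiff_norm_sq ℝ).sub contDiff_const)

theorem contDiff_cutoff {n : ℕ∞} (ρ : ℝ) : ContDiff ℝ n (cutoff ρ) :=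
  contDiff_unitCutoff.comp (contDiff_const_smul _)

theorem cutoff_nonneg (ρ : ℝ) (x : R4) : 0 ≤ cutoff ρ x := Real.smoothTransition.nonneg _

theorem cutoff_le_one (ρ : ℝ) (x : R4) : cutoff ρ x ≤ 1 := Real.smoothTransition.le_one _

theorem unitCutoff_eq_one {x : R4} (h : 2 ≤ ‖x‖) : unitCutoff x = 1 :=
  Real.smoothTransition.one_of_one_le (by nlinarith)

theorem cutoff_eq_zero {ρ : ℝ} (hρ : 0 < ρ) {x : R4} (h : ‖x‖ ≤ ρ) : cutoff ρ x = 0 := by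
  refine Real.smoothTransition.zero_of_nonpos ?_
  rw [norm_smul, norm_inv, Real.norm_of_nonneg hρ.le]
  have : ρ⁻¹ * ‖x‖ ≤ 1 := by
    rw [inv_mul_le_iff₀ hρ]; linarith
  nlinarith [mul_nonneg (inv_nonneg.2 hρ.le) (norm_nonneg x)]

theorem cutoff_eq_one {ρ : ℝ} (hρ : 0 < ρ) {x : R4} (h : 2 * ρ ≤ ‖x‖) : cutoff ρ x = 1 := by
  refine unitCutoff_eq_one ?_
  rw [norm_smul, norm_inv, Real.norm_of_nonneg hρ.le, le_inv_mul_iff₀ hρ]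
  linarith

theorem cutoff_isometry (ρ : ℝ) (γ : R4 ≃ₗᵢ[ℝ] R4) (x : R4) : cutoff ρ (γ x) = cutoff ρ x := by
  simp [cutoff, unitCutoff, norm_smul]

/-- The derivative of the cut-off functions decays like `‖x‖⁻¹`, uniformly in the scale. -/
theorem exists_fderiv_cutoff_bound : ∃ A : ℝ, 0 ≤ A ∧ ∀ ρ : ℝ, 0 < ρ → ∀ x,
    ‖fderiv ℝ (cutoff ρ) x‖ * ‖x‖ ≤ A := by
  have hc : Continuous (fderiv ℝ unitCutoff) :=
    (contDiff_unitCutoff (n := 1)).continuous_fderiv one_ne_zero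
  obtain ⟨A, hA⟩ := (isCompact_closedBall (0 : R4) 2).exists_bound_of_continuousOn hc.continuousOn
  have hA0 : 0 ≤ A := (norm_nonneg _).trans (hA 0 (by simp))
  refine ⟨A * 2, by positivity, fun ρ hρ x => ?_⟩
  have hd : fderiv ℝ (cutoff ρ) x = ρ⁻¹ • fderiv ℝ unitCutoff (ρ⁻¹ • x) := by
    exact fderiv_comp_smul _
  have hn : ‖x‖ = ρ * ‖ρ⁻¹ • x‖ := by
    rw [norm_smul, norm_inv, Real.norm_of_nonneg hρ.le, mul_inv_cancel_left₀ hρ.ne']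
  have key : ‖fderiv ℝ (cutoff ρ) x‖ * ‖x‖ =
      ‖fderiv ℝ unitCutoff (ρ⁻¹ • x)‖ * ‖ρ⁻¹ • x‖ := by
    rw [hd, hn, norm_smul, norm_inv, Real.norm_of_nonneg hρ.le]
    field_simp
  rw [key]
  by_cases h : ‖ρ⁻¹ • x‖ ≤ 2
  · exact mul_le_mul (hA _ (by simpa using h)) h (norm_nonneg _) hA0
  · have h0 : unitCutoff =ᶠ[𝓝 (ρ⁻¹ • x)] fun _ => 1 := by
      filter_upwards [(isOpen_lt continuous_const continuous_norm).mem_nhds (not_le.1 h)] with y hy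
      exact unitCutoff_eq_one (le_of_lt hy)
    rw [h0.fderiv_eq]
    simp [hA0]

theorem rpow_neg_le_of_quarter_le {a s t : ℝ} (ha : 0 ≤ a) (hs : 0 < s) (h : 1 / 4 * s ≤ t) :
    t ^ (-a) ≤ 4 ^ a * s ^ (-a) := by
  calc t ^ (-a) ≤ (1 / 4 * s) ^ (-a) :=
        Real.rpow_le_rpow_of_nonpos (by positivity) h (by linarith)
    _ = 4 ^ a * s ^ (-a) := by
        rw [Real.mul_rpow (by norm_num) hs.le, one_div, Real.inv_rpow (by norm_num),
          Real.rpow_neg (by norm_num), inv_inv]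

end Cutoff

/-! ### The Moser vector field -/

section MoserField

set_option maxSynthPendingDepth 3

/-- The standard symplectic form of `ℝ⁴`, as a bilinear map. -/
noncomputable def stdBilin : R4 →L[ℝ] R4 →L[ℝ] ℝ := (innerSL ℝ).comp stdJ

theorem norm_stdBilin_apply (v : R4) : ‖stdBilin v‖ = ‖v‖ := by
  have h1 : ‖stdBilin v‖ = ‖stdJ v‖ := innerSL_apply_norm ℝ _
  rw [h1, EuclideanSpace.norm_eq, EuclideanSpace.norm_eq]
  congr 1
  simp [stdJ, Fin.sum_univ_four]
  ring

theorem stdBilin_self (v : R4) : stdBilin v v = 0 := by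
  change innerSL ℝ (stdJ v) v = 0
  rw [inner_stdJ]
  ring

theorem exists_equiv_of_le_norm {A : R4 →L[ℝ] R4 →L[ℝ] ℝ} (h : ∀ v, 1 / 2 * ‖v‖ ≤ ‖A v‖) :
    ∃ e : R4 ≃L[ℝ] (R4 →L[ℝ] ℝ), (e : R4 →L[ℝ] R4 →L[ℝ] ℝ) = A := by
  have hinj : Function.Injective (A : R4 →ₗ[ℝ] R4 →L[ℝ] ℝ) := by
    rw [← LinearMap.ker_eq_bot, LinearMap.ker_eq_bot']
    intro v hv
    have h1 := h v
    rw [show A v = 0 from hv, norm_zero] at h1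
    exact norm_eq_zero.1 (le_antisymm (by linarith) (norm_nonneg v))
  have hdim : Module.finrank ℝ R4 = Module.finrank ℝ (R4 →L[ℝ] ℝ) :=
    (InnerProductSpace.toDual ℝ R4).toLinearEquiv.finrank_eq
  let e := LinearEquiv.ofInjectiveOfFinrankEq _ hinj hdim
  exact ⟨e.toContinuousLinearEquiv, rfl⟩

variable {η : R4 → R4 →L[ℝ] R4 →L[ℝ] ℝ}

theorem half_norm_le_norm_stdBilin_add (hsmall : ∀ x, ‖η x‖ ≤ 1 / 4) {t : ℝ}
    (ht : t ∈ Ioo (-1 : ℝ) 2) (x v : R4) : 1 / 2 * ‖v‖ ≤ ‖(stdBilin + t • η x) v‖ := by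
  have h1 : ‖t • η x v‖ ≤ 2 * (1 / 4 * ‖v‖) := by
    rw [norm_smul]
    refine mul_le_mul ?_ ((η x).le_of_opNorm_le (hsmall x) v) (norm_nonneg _) (by norm_num)
    rw [Real.norm_eq_abs, abs_le]
    constructor <;> linarith [ht.1, ht.2]
  have h2 : ‖stdBilin v‖ - ‖t • η x v‖ ≤ ‖stdBilin v + t • η x v‖ := by
    have := norm_sub_norm_le (stdBilin v) (-(t • η x v))
    rwa [norm_neg, sub_neg_eq_add] at this
  rw [norm_stdBilin_apply] at h2
  change _ ≤ ‖stdBilin v + t • η x v‖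
  linarith

/-- The solution `X` of `ι_X (ω₀ + t η) = -α`. -/
noncomputable def moserField (η : R4 → R4 →L[ℝ] R4 →L[ℝ] ℝ) (α : R4 → R4 →L[ℝ] ℝ)
    (z : ℝ × R4) : R4 :=
  -(stdBilin + z.1 • η z.2).inverse (α z.2)

variable {α : R4 → R4 →L[ℝ] ℝ} (hsmall : ∀ x, ‖η x‖ ≤ 1 / 4)
include hsmall

theorem contDiffOn_moserField {n : WithTop ℕ∞} (hη : ContDiff ℝ n η) (hα : ContDiff ℝ n α) :
    ContDiffOn ℝ n (moserField η α) (Ioo (-1) 2 ×ˢ univ) := by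
  rintro ⟨t, x⟩ ⟨ht, -⟩
  obtain ⟨e, he⟩ := exists_equiv_of_le_norm (half_norm_le_norm_stdBilin_add hsmall ht x)
  have h1 : ContDiffAt ℝ n (fun z : ℝ × R4 => stdBilin + z.1 • η z.2) (t, x) :=
    (contDiff_const.add (contDiff_fst.smul (hη.comp contDiff_snd))).contDiffAt
  have h2 : ContDiffAt ℝ n ContinuousLinearMap.inverse (stdBilin + t • η x) := by
    rw [← he]; exact contDiffAt_map_inverse e
  exact ((ContDiffAt.comp (t, x) h2 h1).clm_apply
    (hα.comp contDiff_snd).contDiffAt).neg.contDiffWithinAt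

theorem moserField_spec {t : ℝ} (ht : t ∈ Ioo (-1 : ℝ) 2) (x : R4) :
    (stdBilin + t • η x) (moserField η α (t, x)) = -α x := by
  obtain ⟨e, he⟩ := exists_equiv_of_le_norm (half_norm_le_norm_stdBilin_add hsmall ht x)
  simp only [moserField, map_neg]
  rw [← he, ContinuousLinearMap.inverse_equiv]
  simp

theorem norm_moserField_le {t : ℝ} (ht : t ∈ Ioo (-1 : ℝ) 2) (x : R4) :
    ‖moserField η α (t, x)‖ ≤ 2 * ‖α x‖ := by
  have h1 := half_norm_le_norm_stdBilin_add hsmall ht x (moserField η α (t, x))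
  rw [moserField_spec hsmall ht, norm_neg] at h1
  linarith

theorem fderiv_moserField_spec (hη : ContDiff ℝ 1 η) (hα : ContDiff ℝ 1 α) {t : ℝ}
    (ht : t ∈ Ioo (-1 : ℝ) 2) (x w : R4) :
    (stdBilin + t • η x) (fderiv ℝ (moserField η α) (t, x) (0, w)) =
      -fderiv ℝ α x w - t • fderiv ℝ η x w (moserField η α (t, x)) := by
  have hO : (Ioo (-1 : ℝ) 2 ×ˢ (univ : Set R4)) ∈ 𝓝 (t, x) :=
    (isOpen_Ioo.prod isOpen_univ).mem_nhds ⟨ht, mem_univ _⟩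
  have h1 := (((contDiffOn_moserField hsmall hη hα).contDiffAt hO).differentiableAt
    one_ne_zero).hasFDerivAt.comp x (hasFDerivAt_prodMk_right t x)
  have h2 : HasFDerivAt (fun y => stdBilin + t • η y) (t • fderiv ℝ η x) x :=
    (((hη.differentiable one_ne_zero) x).hasFDerivAt.const_smul t).const_add stdBilin
  have h3 := h2.clm_apply h1
  have h4 : (fun y => (stdBilin + t • η y) ((moserField η α ∘ Prod.mk t) y)) = fun y => -α y :=
    funext fun y => moserField_spec hsmall ht y
  rw [h4] at h3
  have h5 := DFunLike.congr_fun
    (h3.unique ((hα.differentiable one_ne_zero) x).hasFDerivAt.neg) w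
  rw [eq_sub_iff_add_eq]
  exact h5

theorem norm_fderiv_moserField_le (hη : ContDiff ℝ 1 η) (hα : ContDiff ℝ 1 α) {t : ℝ}
    (ht : t ∈ Ioo (-1 : ℝ) 2) (x w : R4) :
    ‖fderiv ℝ (moserField η α) (t, x) (0, w)‖ ≤
      2 * (‖fderiv ℝ α x‖ + 4 * (‖fderiv ℝ η x‖ * ‖α x‖)) * ‖w‖ := by
  have h1 := half_norm_le_norm_stdBilin_add hsmall ht x (fderiv ℝ (moserField η α) (t, x) (0, w))
  rw [fderiv_moserField_spec hsmall hη hα ht] at h1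
  have h2 : ‖fderiv ℝ η x w (moserField η α (t, x))‖ ≤ ‖fderiv ℝ η x‖ * ‖w‖ * (2 * ‖α x‖) :=
    ContinuousLinearMap.le_of_opNorm_le_of_le _ ((fderiv ℝ η x).le_opNorm w)
      (norm_moserField_le hsmall ht x)
  have h3 : ‖t • fderiv ℝ η x w (moserField η α (t, x))‖ ≤
      2 * (‖fderiv ℝ η x‖ * ‖w‖ * (2 * ‖α x‖)) := by
    rw [norm_smul]
    refine mul_le_mul ?_ h2 (norm_nonneg _) (by norm_num)
    rw [Real.norm_eq_abs, abs_le]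
    constructor <;> linarith [ht.1, ht.2]
  have h4 := norm_sub_le (-fderiv ℝ α x w) (t • fderiv ℝ η x w (moserField η α (t, x)))
  rw [norm_neg] at h4
  have h5 := (fderiv ℝ α x).le_opNorm w
  calc _ ≤ 2 * (‖fderiv ℝ α x‖ * ‖w‖ + 2 * (‖fderiv ℝ η x‖ * ‖w‖ * (2 * ‖α x‖))) := by
        linarith
    _ = _ := by ring

theorem moserField_isometry {γ : R4 ≃ₗᵢ[ℝ] R4}
    (hγ0 : ∀ u v, stdBilin (γ u) (γ v) = stdBilin u v)
    (hγη : ∀ x u v, η (γ x) (γ u) (γ v) = η x u v) (hγα : ∀ x v, α (γ x) (γ v) = α x v)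
    {t : ℝ} (ht : t ∈ Ioo (-1 : ℝ) 2) (x : R4) :
    moserField η α (t, γ x) = γ (moserField η α (t, x)) := by
  obtain ⟨e, he⟩ := exists_equiv_of_le_norm (half_norm_le_norm_stdBilin_add hsmall ht (γ x))
  apply e.injective
  change (e : R4 →L[ℝ] R4 →L[ℝ] ℝ) _ = (e : R4 →L[ℝ] R4 →L[ℝ] ℝ) _
  rw [he, moserField_spec hsmall ht]
  ext v
  obtain ⟨u, rfl⟩ := γ.surjective v
  have h1 := DFunLike.congr_fun (moserField_spec (α := α) hsmall ht x) u
  simp only [add_apply, smul_apply, neg_apply] at h1 ⊢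
  rw [hγ0, hγη, hγα, ← h1]

end MoserField

/-! ### Moser isotopy near infinity -/

section MoserFlow

set_option maxSynthPendingDepth 3

variable {η : R4 → R4 →L[ℝ] R4 →L[ℝ] ℝ} {α : R4 → R4 →L[ℝ] ℝ}

/-- The Moser vector field, cut off to the region `‖x‖ > ρ`. -/
noncomputable def truncatedField (η : R4 → R4 →L[ℝ] R4 →L[ℝ] ℝ) (α : R4 → R4 →L[ℝ] ℝ) (ρ : ℝ)
    (z : ℝ × R4) : R4 :=
  cutoff ρ z.2 • moserField η α z

theorem contDiffOn_truncatedField (hsmall : ∀ x, ‖η x‖ ≤ 1 / 4) (hη : ContDiff ℝ 2 η)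
    (hα : ContDiff ℝ 2 α) (ρ : ℝ) :
    ContDiffOn ℝ 2 (truncatedField η α ρ) (Ioo (-1) 2 ×ˢ univ) :=
  ((contDiff_cutoff (n := 2) ρ).comp contDiff_snd).contDiffOn.smul
    (contDiffOn_moserField hsmall hη hα)

theorem fderiv_truncatedField (hsmall : ∀ x, ‖η x‖ ≤ 1 / 4) (hη : ContDiff ℝ 2 η)
    (hα : ContDiff ℝ 2 α) (ρ : ℝ) {t : ℝ} (ht : t ∈ Ioo (-1 : ℝ) 2) (x w : R4) :
    fderiv ℝ (truncatedField η α ρ) (t, x) (0, w) =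
      cutoff ρ x • fderiv ℝ (moserField η α) (t, x) (0, w) +
        fderiv ℝ (cutoff ρ) x w • moserField η α (t, x) := by
  have hO : (Ioo (-1 : ℝ) 2 ×ˢ (univ : Set R4)) ∈ 𝓝 (t, x) :=
    (isOpen_Ioo.prod isOpen_univ).mem_nhds ⟨ht, mem_univ _⟩
  have h1 := (((contDiffOn_moserField hsmall hη hα).contDiffAt hO).differentiableAt
    two_ne_zero).hasFDerivAt
  have h2 : HasFDerivAt (fun z : ℝ × R4 => cutoff ρ z.2)
      ((fderiv ℝ (cutoff ρ) x).comp (ContinuousLinearMap.snd ℝ ℝ R4)) (t, x) :=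
    HasFDerivAt.comp (g := cutoff ρ) (f := Prod.snd) (t, x)
      ((contDiff_cutoff (n := 1) ρ).differentiable one_ne_zero x).hasFDerivAt hasFDerivAt_snd
  have h3 : HasFDerivAt (truncatedField η α ρ) _ (t, x) := h2.smul h1
  rw [h3.fderiv]
  simp

theorem isometry_truncatedField (hsmall : ∀ x, ‖η x‖ ≤ 1 / 4) {γ : R4 ≃ₗᵢ[ℝ] R4}
    (hγ0 : ∀ u v, stdBilin (γ u) (γ v) = stdBilin u v)
    (hγη : ∀ x u v, η (γ x) (γ u) (γ v) = η x u v) (hγα : ∀ x v, α (γ x) (γ v) = α x v)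
    (ρ : ℝ) {t : ℝ} (ht : t ∈ Ioo (-1 : ℝ) 2) (x : R4) :
    truncatedField η α ρ (t, γ x) = γ (truncatedField η α ρ (t, x)) := by
  simp only [truncatedField, cutoff_isometry, map_smul,
    moserField_isometry hsmall hγ0 hγη hγα ht]

/-- Moser's computation: along a flow line that stays where `η` is closed and `dα = η`, the
pull-back of `ω₀ + t η` is constant in `t`. -/
theorem hasDerivWithinAt_pullback_zero (hsmall : ∀ x, ‖η x‖ ≤ 1 / 4) (halt : ∀ x v, η x v v = 0)
    (hη : ContDiff ℝ 1 η) (hα : ContDiff ℝ 1 α) {s : Set ℝ} {t : ℝ} (ht : t ∈ Ioo (-1 : ℝ) 2)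
    {ξ a b : ℝ → R4} (hξ : HasDerivWithinAt ξ (moserField η α (t, ξ t)) s t)
    (ha : HasDerivWithinAt a (fderiv ℝ (moserField η α) (t, ξ t) (0, a t)) s t)
    (hb : HasDerivWithinAt b (fderiv ℝ (moserField η α) (t, ξ t) (0, b t)) s t)
    (hcl : IsClosedFormAt η (ξ t))
    (hprim : ∀ u v, fderiv ℝ α (ξ t) u v - fderiv ℝ α (ξ t) v u = η (ξ t) u v) :
    HasDerivWithinAt (fun t => (stdBilin + t • η (ξ t)) (a t) (b t)) 0 s t := by
  have h1 : HasDerivWithinAt (fun t => η (ξ t))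
      (fderiv ℝ η (ξ t) (moserField η α (t, ξ t))) s t :=
    ((hη.differentiable one_ne_zero _).hasFDerivAt).comp_hasDerivWithinAt t hξ
  have h2 := ((((hasDerivWithinAt_id t s).smul h1).const_add stdBilin).clm_apply ha).clm_apply hb
  refine h2.congr_deriv ?_
  have hskew : ∀ u v, (stdBilin + t • η (ξ t)) u v = -(stdBilin + t • η (ξ t)) v u := fun u v => by
    have e1 := stdBilin_self (u + v)
    have e2 := halt (ξ t) (u + v)
    simp only [map_add, add_apply, stdBilin_self, halt] at e1 e2
    simp only [add_apply, smul_apply, smul_eq_mul]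
    linear_combination e1 + t * e2
  have e1 := DFunLike.congr_fun (fderiv_moserField_spec hsmall hη hα ht (ξ t) (a t)) (b t)
  have e2 := DFunLike.congr_fun (fderiv_moserField_spec hsmall hη hα ht (ξ t) (b t)) (a t)
  have e3 := hskew (a t) (fderiv ℝ (moserField η α) (t, ξ t) (0, b t))
  have e4 := hcl (moserField η α (t, ξ t)) (a t) (b t)
  have e5 := hprim (a t) (b t)
  simp only [Pi.smul_apply', id, add_apply, smul_apply, smul_eq_mul, neg_apply, sub_apply,
    one_smul] at e1 e2 e3 ⊢
  linear_combination e1 - e2 + e3 + t * e4 - e5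

theorem hasDerivWithinAt_Ici_of_Icc {E : Type*} [NormedAddCommGroup E] [NormedSpace ℝ E]
    {f : ℝ → E} {f' : E} {t : ℝ} (ht : t ∈ Ico (0 : ℝ) 1)
    (h : HasDerivWithinAt f f' (Icc 0 1) t) : HasDerivWithinAt f f' (Ici t) t :=
  h.mono_of_mem_nhdsWithin (Icc_mem_nhdsGE_of_mem ht)

/-- If the Moser data `η, α` decay at infinity, the time-one map of the truncated Moser field is
a global diffeomorphism that is asymptotic to the identity and pulls `ω₀ + η` back to `ω₀` near
infinity. -/
theorem exists_moser_diffeo (hη : ContDiff ℝ 2 η) (hα : ContDiff ℝ 2 α)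
    (hsmall : ∀ x, ‖η x‖ ≤ 1 / 4) (halt : ∀ x v, η x v v = 0) {r C ε : ℝ} (hε : 0 < ε)
    (hC : 0 ≤ C) (hα0 : ∀ x, r ≤ ‖x‖ → ‖α x‖ ≤ C * ‖x‖ ^ (-ε))
    (hα1 : ∀ x, r ≤ ‖x‖ → ‖fderiv ℝ α x‖ ≤ C * ‖x‖ ^ (-1 - ε))
    (hηα : ∀ x, r ≤ ‖x‖ → ‖fderiv ℝ η x‖ * ‖α x‖ ≤ C * ‖x‖ ^ (-1 - ε))
    (hcl : ∀ x, r ≤ ‖x‖ → IsClosedFormAt η x)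
    (hprim : ∀ x, r ≤ ‖x‖ → ∀ u v, fderiv ℝ α x u v - fderiv ℝ α x v u = η x u v) :
    ∃ (Ψ : R4 ≃ₜ R4) (c C' : ℝ), ContDiff ℝ 2 Ψ ∧ ContDiff ℝ 2 Ψ.symm ∧
      (∀ x, ‖Ψ x - x‖ ≤ 1) ∧
      (∀ γ : R4 ≃ₗᵢ[ℝ] R4, (∀ u v, stdBilin (γ u) (γ v) = stdBilin u v) →
        (∀ x u v, η (γ x) (γ u) (γ v) = η x u v) → (∀ x v, α (γ x) (γ v) = α x v) →
        ∀ x, Ψ (γ x) = γ (Ψ x)) ∧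
      (∀ x, c < ‖x‖ → ∀ u v, (stdBilin + η (Ψ x)) (fderiv ℝ Ψ x u) (fderiv ℝ Ψ x v) =
        stdBilin u v) ∧
      (∀ x, c < ‖x‖ → ‖Ψ x - x‖ ≤ C' * ‖x‖ ^ (-ε)) ∧
      (∀ x, c < ‖x‖ → ‖fderiv ℝ Ψ x - ContinuousLinearMap.id ℝ R4‖ ≤ C' * ‖x‖ ^ (-1 - ε)) := by
  obtain ⟨A, hA0, hA⟩ := exists_fderiv_cutoff_bound
  -- a bound for the spatial derivative of every truncated field
  let k : ℝ := 2 * (C + 4 * C) + A * (2 * C)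
  have hk : 0 ≤ k := by positivity
  obtain ⟨ρ, hρ1, hρr, hρC, hρk⟩ : ∃ ρ : ℝ, 1 ≤ ρ ∧ r ≤ ρ ∧ 2 * C * ρ ^ (-ε) ≤ 1 ∧
      k * ρ ^ (-ε) ≤ 1 / 4 := by
    have h1 : Tendsto (fun ρ : ℝ => 2 * C * ρ ^ (-ε)) atTop (𝓝 (2 * C * 0)) :=
      (tendsto_rpow_neg_atTop hε).const_mul _
    have h2 : Tendsto (fun ρ : ℝ => k * ρ ^ (-ε)) atTop (𝓝 (k * 0)) :=
      (tendsto_rpow_neg_atTop hε).const_mul _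
    rw [mul_zero] at h1 h2
    exact ((eventually_ge_atTop 1).and ((eventually_ge_atTop r).and
      ((h1.eventually_le_const one_pos).and
        (h2.eventually_le_const (by norm_num : (0 : ℝ) < 1 / 4))))).exists
  have hρ0 : 0 < ρ := by linarith
  have hI : ∀ t ∈ Icc (0 : ℝ) 1, t ∈ Ioo (-1 : ℝ) 2 := fun t ht =>
    ⟨by linarith [ht.1], by linarith [ht.2]⟩
  set Y := truncatedField η α ρ with hYdef
  have hη1 : ContDiff ℝ 1 η := hη.of_le one_le_two
  have hα1' : ContDiff ℝ 1 α := hα.of_le one_le_two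
  have hX0 : ∀ t ∈ Icc (0 : ℝ) 1, ∀ x, ρ ≤ ‖x‖ →
      ‖moserField η α (t, x)‖ ≤ 2 * C * ‖x‖ ^ (-ε) := fun t ht x hx => by
    have := norm_moserField_le (α := α) hsmall (hI t ht) x
    linarith [hα0 x (hρr.trans hx)]
  have hY0 : ∀ t ∈ Icc (0 : ℝ) 1, ∀ x, ρ ≤ ‖x‖ → ‖Y (t, x)‖ ≤ 2 * C * ‖x‖ ^ (-ε) :=
    fun t ht x hx => by
      refine le_trans ?_ (hX0 t ht x hx)
      rw [hYdef, truncatedField, norm_smul, Real.norm_of_nonneg (cutoff_nonneg _ _)]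
      exact mul_le_of_le_one_left (norm_nonneg _) (cutoff_le_one _ _)
  have hYle : ∀ t ∈ Icc (0 : ℝ) 1, ∀ x, ‖Y (t, x)‖ ≤ 1 := fun t ht x => by
    rcases le_total ρ ‖x‖ with hx | hx
    · refine (hY0 t ht x hx).trans (le_trans ?_ hρC)
      have := Real.rpow_le_rpow_of_nonpos hρ0 hx (by linarith : -ε ≤ 0)
      exact mul_le_mul_of_nonneg_left this (by positivity)
    · simp [hYdef, truncatedField, cutoff_eq_zero hρ0 hx]
  have hDY : ∀ t ∈ Icc (0 : ℝ) 1, ∀ x, ρ ≤ ‖x‖ → ∀ w,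
      ‖fderiv ℝ Y (t, x) (0, w)‖ ≤ k * ‖x‖ ^ (-1 - ε) * ‖w‖ := fun t ht x hx w => by
    have hx0 : 0 < ‖x‖ := hρ0.trans_le hx
    rw [hYdef, fderiv_truncatedField hsmall hη hα ρ (hI t ht)]
    have h1 : ‖cutoff ρ x • fderiv ℝ (moserField η α) (t, x) (0, w)‖ ≤
        2 * (C + 4 * C) * ‖x‖ ^ (-1 - ε) * ‖w‖ := by
      rw [norm_smul, Real.norm_of_nonneg (cutoff_nonneg _ _)]
      refine (mul_le_of_le_one_left (norm_nonneg _) (cutoff_le_one _ _)).trans ?_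
      refine (norm_fderiv_moserField_le hsmall hη1 hα1' (hI t ht) x w).trans ?_
      refine mul_le_mul_of_nonneg_right ?_ (norm_nonneg _)
      linarith [hα1 x (hρr.trans hx), hηα x (hρr.trans hx)]
    have h2 : ‖fderiv ℝ (cutoff ρ) x w • moserField η α (t, x)‖ ≤
        A * (2 * C) * ‖x‖ ^ (-1 - ε) * ‖w‖ := by
      rw [norm_smul]
      have h3 := (fderiv ℝ (cutoff ρ) x).le_opNorm w
      have h4 : ‖fderiv ℝ (cutoff ρ) x‖ ≤ A * ‖x‖⁻¹ := by
        rw [← div_eq_mul_inv, le_div_iff₀ hx0]; exact hA ρ hρ0 x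
      have h5 : ‖x‖ ^ (-1 - ε) = ‖x‖⁻¹ * ‖x‖ ^ (-ε) := by
        rw [sub_eq_add_neg, Real.rpow_add hx0, Real.rpow_neg_one]
      calc _ ≤ (A * ‖x‖⁻¹ * ‖w‖) * (2 * C * ‖x‖ ^ (-ε)) := by
            refine mul_le_mul (h3.trans ?_) (hX0 t ht x hx) (norm_nonneg _) (by positivity)
            exact mul_le_mul_of_nonneg_right h4 (norm_nonneg _)
        _ = _ := by rw [h5]; ring
    refine (norm_add_le _ _).trans ((add_le_add h1 h2).trans (le_of_eq ?_))
    simp only [k]; ring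
  have hDYle : ∀ t ∈ Icc (0 : ℝ) 1, ∀ x w, ‖fderiv ℝ Y (t, x) (0, w)‖ ≤ 1 / 4 * ‖w‖ :=
    fun t ht x w => by
      rcases le_or_gt ρ ‖x‖ with hx | hx
      · refine (hDY t ht x hx w).trans (mul_le_mul_of_nonneg_right ?_ (norm_nonneg _))
        refine le_trans (mul_le_mul_of_nonneg_left ?_ hk) hρk
        calc ‖x‖ ^ (-1 - ε) ≤ ‖x‖ ^ (-ε) :=
              Real.rpow_le_rpow_of_exponent_le (hρ1.trans hx) (by linarith)
          _ ≤ ρ ^ (-ε) := Real.rpow_le_rpow_of_nonpos hρ0 hx (by linarith)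
      · have h0 : cutoff ρ =ᶠ[𝓝 x] fun _ => 0 := by
          filter_upwards [(isOpen_lt continuous_norm continuous_const).mem_nhds hx] with y hy
          exact cutoff_eq_zero hρ0 (le_of_lt hy)
        rw [hYdef, fderiv_truncatedField hsmall hη hα ρ (hI t ht), h0.fderiv_eq,
          cutoff_eq_zero hρ0 hx.le]
        simp
  have hO : IsOpen (Ioo (-1 : ℝ) 2 ×ˢ (univ : Set R4)) := isOpen_Ioo.prod isOpen_univ
  have hY2 : ContDiffOn ℝ (2 : ℕ) Y (Ioo (-1) 2 ×ˢ univ) :=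
    contDiffOn_truncatedField hsmall hη hα ρ
  obtain ⟨φ, hφ2, hφ0, hφd, hφA⟩ := exists_flow two_ne_zero hO
    (fun t ht x => ⟨hI t ht, mem_univ _⟩) hY2 (fun t ht x =>
      ContinuousLinearMap.opNorm_le_bound _ (by norm_num) fun w => hDYle t ht x w)
  have hA00 : ∀ x w, fderiv ℝ (φ 0) x w = w := fun x w => by
    have : φ 0 = id := funext hφ0
    rw [this, fderiv_id]; rfl
  have h1mem : (1 : ℝ) ∈ Icc (0 : ℝ) 1 := by simp
  have hmove : ∀ x, ∀ t ∈ Icc (0 : ℝ) 1, ‖φ t x - x‖ ≤ 1 := fun x t ht => by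
    have := norm_image_sub_le_of_norm_deriv_le_segment' (hφd x)
      (fun s hs => hYle s (Ico_subset_Icc_self hs) _) t ht
    rw [hφ0] at this
    linarith [ht.2]
  have hAle : ∀ x w, ∀ t ∈ Icc (0 : ℝ) 1, ‖fderiv ℝ (φ t) x w‖ ≤ 3 * ‖w‖ := fun x w t ht => by
    have h1 := norm_le_gronwallBound_of_norm_deriv_right_le (δ := ‖w‖) (K := 1 / 4) (ε := 0)
      (fun s hs => (hφA x w s hs).continuousWithinAt)
      (fun s hs => hasDerivWithinAt_Ici_of_Icc hs (hφA x w s (Ico_subset_Icc_self hs)))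
      (by rw [hA00]) (fun s hs => by
        rw [add_zero]; exact hDYle s (Ico_subset_Icc_self hs) _ _) t ht
    rw [gronwallBound_ε0, sub_zero] at h1
    have h2 : Real.exp (1 / 4 * t) ≤ 3 :=
      (Real.exp_le_exp.2 (by linarith [ht.2] : 1 / 4 * t ≤ 1)).trans
        (by linarith [Real.exp_one_lt_d9])
    rw [mul_comm 3]
    exact h1.trans (mul_le_mul_of_nonneg_left h2 (norm_nonneg _))
  have hAsub : ∀ x b, 0 ≤ b → (∀ t ∈ Icc (0 : ℝ) 1, ∀ w,
      ‖fderiv ℝ Y (t, φ t x) (0, w)‖ ≤ b * ‖w‖) →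
      ‖fderiv ℝ (φ 1) x - ContinuousLinearMap.id ℝ R4‖ ≤ b * 3 := fun x b hb hbw => by
    refine ContinuousLinearMap.opNorm_le_bound _ (by positivity) fun w => ?_
    have := norm_image_sub_le_of_norm_deriv_le_segment' (hφA x w) (C := b * (3 * ‖w‖))
      (fun s hs => (hbw s (Ico_subset_Icc_self hs) _).trans
        (mul_le_mul_of_nonneg_left (hAle x w s (Ico_subset_Icc_self hs)) hb)) 1 h1mem
    rw [hA00] at this
    simpa [mul_assoc] using this
  obtain ⟨Ψ, hΨ, hΨs⟩ := exists_homeomorph_of_fderiv_sub_id two_ne_zero (hφ2 1)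
    (c := 1 / 4 * 3) (by norm_num) fun x =>
      hAsub x (1 / 4) (by norm_num) fun t ht w => hDYle t ht _ w
  have hΨφ : (Ψ : R4 → R4) = φ 1 := funext hΨ
  -- for `‖x‖ > 2 ρ + 2` the trajectory of `x` stays where the cut-off function is `1`
  have hfar : ∀ x, 2 * ρ + 2 < ‖x‖ → ∀ t ∈ Icc (0 : ℝ) 1,
      2 * ρ < ‖φ t x‖ ∧ 1 / 4 * ‖x‖ ≤ ‖φ t x‖ := fun x hx t ht => by
    have h1 := norm_sub_norm_le x (φ t x)
    rw [norm_sub_rev] at h1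
    have h2 := hmove x t ht
    constructor <;> linarith
  refine ⟨Ψ, 2 * ρ + 2, max (2 * C * 4 ^ ε) (k * 4 ^ (1 + ε) * 3), ?_, hΨs, ?_, ?_, ?_, ?_, ?_⟩
  · rw [hΨφ]; exact hφ2 1
  · intro x
    rw [hΨφ]; exact hmove x 1 h1mem
  · intro γ hγ0 hγη hγα x
    have hlip : ∀ t ∈ Ico (0 : ℝ) 1, LipschitzOnWith (1 / 4) (fun y => Y (t, y)) univ :=
      fun t ht => by
        have htI := hI t (Ico_subset_Icc_self ht)
        have hd : ∀ y ∈ univ, HasFDerivWithinAt (fun y => Y (t, y))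
            ((fderiv ℝ Y (t, y)).comp (ContinuousLinearMap.inr ℝ ℝ R4)) univ y := fun y _ =>
          ((((hY2.contDiffAt (hO.mem_nhds ⟨htI, mem_univ y⟩)).differentiableAt
            two_ne_zero).hasFDerivAt).comp y (hasFDerivAt_prodMk_right t y)).hasFDerivWithinAt
        refine convex_univ.lipschitzOnWith_of_nnnorm_hasFDerivWithin_le hd fun y _ => ?_
        refine ContinuousLinearMap.opNorm_le_bound _ (by norm_num) fun w => ?_
        simpa using hDYle t (Ico_subset_Icc_self ht) y w
    have hd2 : ∀ t ∈ Icc (0 : ℝ) 1, HasDerivWithinAt (fun s => γ (φ s x))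
        (Y (t, γ (φ t x))) (Icc 0 1) t := fun t ht => by
      rw [hYdef, isometry_truncatedField hsmall hγ0 hγη hγα ρ (hI t ht)]
      exact (γ.toContinuousLinearEquiv : R4 →L[ℝ] R4).hasFDerivAt.comp_hasDerivWithinAt t
        (hφd x t ht)
    have h3 := ODE_solution_unique_of_mem_Icc_right (v := fun t y => Y (t, y))
      (s := fun _ => univ) (K := 1 / 4) hlip
      (fun s hs => (hφd (γ x) s hs).continuousWithinAt)
      (fun s hs => hasDerivWithinAt_Ici_of_Icc hs (hφd (γ x) s (Ico_subset_Icc_self hs)))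
      (fun _ _ => mem_univ _)
      (fun s hs => (hd2 s hs).continuousWithinAt)
      (fun s hs => hasDerivWithinAt_Ici_of_Icc hs (hd2 s (Ico_subset_Icc_self hs)))
      (fun _ _ => mem_univ _) (by simp [hφ0])
    rw [hΨφ]
    exact h3 h1mem
  · intro x hx u v
    have hYX : ∀ t ∈ Icc (0 : ℝ) 1, ∀ y, 2 * ρ < ‖y‖ → Y (t, y) = moserField η α (t, y) ∧
        ∀ w, fderiv ℝ Y (t, y) (0, w) = fderiv ℝ (moserField η α) (t, y) (0, w) :=
      fun t ht y hy => by
        have h0 : cutoff ρ =ᶠ[𝓝 y] fun _ => 1 := by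
          filter_upwards [(isOpen_lt continuous_const continuous_norm).mem_nhds hy] with z hz
          exact cutoff_eq_one hρ0 (le_of_lt hz)
        refine ⟨by simp [hYdef, truncatedField, cutoff_eq_one hρ0 hy.le], fun w => ?_⟩
        rw [hYdef, fderiv_truncatedField hsmall hη hα ρ (hI t ht), h0.fderiv_eq,
          cutoff_eq_one hρ0 hy.le]
        simp
    have hder : ∀ t ∈ Icc (0 : ℝ) 1, HasDerivWithinAt (fun t =>
        (stdBilin + t • η (φ t x)) (fderiv ℝ (φ t) x u) (fderiv ℝ (φ t) x v)) 0 (Icc 0 1) t :=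
      fun t ht => by
        have hy := (hfar x hx t ht).1
        have hr : r ≤ ‖φ t x‖ := by linarith
        have e1 := hφd x t ht
        have e2 := hφA x u t ht
        have e3 := hφA x v t ht
        rw [(hYX t ht _ hy).1] at e1
        rw [(hYX t ht _ hy).2] at e2 e3
        exact hasDerivWithinAt_pullback_zero hsmall halt hη1 hα1' (hI t ht) e1 e2 e3
          (hcl _ hr) (hprim _ hr)
    have hconst := constant_of_has_deriv_right_zero
      (fun t ht => (hder t ht).continuousWithinAt)
      (fun t ht => hasDerivWithinAt_Ici_of_Icc ht (hder t (Ico_subset_Icc_self ht))) 1 h1mem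
    simp only [hA00, one_smul, zero_smul, add_zero] at hconst
    rw [hΨφ]
    exact hconst
  · intro x hx
    have hx0 : 0 < ‖x‖ := by linarith
    have := norm_image_sub_le_of_norm_deriv_le_segment' (hφd x)
      (C := 2 * C * (4 ^ ε * ‖x‖ ^ (-ε))) (fun s hs => by
        have hs' := Ico_subset_Icc_self hs
        obtain ⟨h1, h2⟩ := hfar x hx s hs'
        refine (hY0 s hs' _ (by linarith)).trans ?_
        exact mul_le_mul_of_nonneg_left (rpow_neg_le_of_quarter_le hε.le hx0 h2)
          (by positivity)) 1 h1mem
    rw [hφ0, sub_zero, mul_one] at this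
    rw [hΨφ]
    refine this.trans ?_
    rw [← mul_assoc]
    exact mul_le_mul_of_nonneg_right (le_max_left _ _) (by positivity)
  · intro x hx
    have hx0 : 0 < ‖x‖ := by linarith
    have := hAsub x (k * (4 ^ (1 + ε) * ‖x‖ ^ (-1 - ε))) (by positivity) fun t ht w => by
      obtain ⟨h1, h2⟩ := hfar x hx t ht
      refine (hDY t ht _ (by linarith) w).trans (mul_le_mul_of_nonneg_right ?_ (norm_nonneg _))
      have h3 := rpow_neg_le_of_quarter_le (a := 1 + ε) (by positivity) hx0 h2
      rw [neg_add'] at h3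
      exact mul_le_mul_of_nonneg_left h3 hk
    rw [hΨφ]
    refine this.trans ?_
    calc k * (4 ^ (1 + ε) * ‖x‖ ^ (-1 - ε)) * 3 = k * 4 ^ (1 + ε) * 3 * ‖x‖ ^ (-1 - ε) := by ring
      _ ≤ _ := mul_le_mul_of_nonneg_right (le_max_right _ _) (by positivity)

end MoserFlow

/-! ### The theorem of Darboux at infinity for bilinear forms -/

section Darboux

set_option maxSynthPendingDepth 3

/-- The average of a `1`-form over a finite group of linear isometries is invariant, obeys the
bounds that hold for the `1`-form on the orbits, and its exterior derivative is the average of the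
exterior derivative. -/
theorem exists_invariant_average (Γ : Subgroup (R4 ≃ₗᵢ[ℝ] R4)) [Finite Γ]
    {β : R4 → R4 →L[ℝ] ℝ} (hβ : ContDiff ℝ 2 β) :
    ∃ α : R4 → R4 →L[ℝ] ℝ, ContDiff ℝ 2 α ∧
      (∀ γ ∈ Γ, ∀ x v, α (γ x) (γ v) = α x v) ∧
      (∀ x b, (∀ γ ∈ Γ, ‖β (γ x)‖ ≤ b) → ‖α x‖ ≤ b) ∧
      (∀ x b, (∀ γ ∈ Γ, ‖fderiv ℝ β (γ x)‖ ≤ b) → ‖fderiv ℝ α x‖ ≤ b) ∧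
      (∀ x u v b, (∀ γ ∈ Γ, fderiv ℝ β (γ x) (γ u) (γ v) - fderiv ℝ β (γ x) (γ v) (γ u) = b) →
        fderiv ℝ α x u v - fderiv ℝ α x v u = b) := by
  have := Fintype.ofFinite Γ
  let G : Γ → R4 →L[ℝ] R4 := fun γ => (γ.1.toContinuousLinearEquiv : R4 →L[ℝ] R4)
  have hG : ∀ γ x, G γ x = γ.1 x := fun _ _ => rfl
  have hG1 : ∀ γ v, ‖G γ v‖ ≤ 1 * ‖v‖ := fun γ v => by
    rw [hG, LinearIsometryEquiv.norm_map, one_mul]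
  let N : ℝ := Fintype.card Γ
  have hN : 0 < N := Nat.cast_pos.2 (Fintype.card_pos (α := Γ))
  have havg : ∀ b : ℝ, N⁻¹ * ∑ _γ : Γ, b = b := fun b => by
    rw [Finset.sum_const, Finset.card_univ, nsmul_eq_mul, inv_mul_cancel_left₀ hN.ne']
  let α : R4 → R4 →L[ℝ] ℝ := fun x => N⁻¹ • ∑ γ : Γ, (β (G γ x)).comp (G γ)
  have hαapp : ∀ x v, α x v = N⁻¹ * ∑ γ : Γ, β (G γ x) (G γ v) := fun x v => by
    simp [α]
  have hβd : ∀ γ x, HasFDerivAt (fun x => (β (G γ x)).comp (G γ))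
      (((ContinuousLinearMap.compL ℝ R4 R4 ℝ).flip (G γ)).comp
        ((fderiv ℝ β (G γ x)).comp (G γ))) x := fun γ x =>
    ((ContinuousLinearMap.compL ℝ R4 R4 ℝ).flip (G γ)).hasFDerivAt.comp x
      (((hβ.differentiable two_ne_zero _).hasFDerivAt).comp x (G γ).hasFDerivAt)
  have hαd : ∀ x u v, fderiv ℝ α x u v = N⁻¹ * ∑ γ : Γ, fderiv ℝ β (G γ x) (G γ u) (G γ v) :=
    fun x u v => by
      have h1 : HasFDerivAt α (N⁻¹ • ∑ γ : Γ, ((ContinuousLinearMap.compL ℝ R4 R4 ℝ).flip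
          (G γ)).comp ((fderiv ℝ β (G γ x)).comp (G γ))) x :=
        (HasFDerivAt.fun_sum fun γ _ => hβd γ x).const_smul N⁻¹
      rw [h1.fderiv]
      simp
  have hαC : ContDiff ℝ 2 (fun x => ∑ γ : Γ, (β (G γ x)).comp (G γ)) :=
    ContDiff.sum fun γ _ => (hβ.comp (G γ).contDiff).clm_comp contDiff_const
  refine ⟨α, hαC.const_smul N⁻¹, fun γ hγ x v => ?_, fun x b hb => ?_,
    fun x b hb => ?_, fun x u v b hb => ?_⟩
  · rw [hαapp, hαapp]
    congr 1
    exact Fintype.sum_equiv (Equiv.mulRight (⟨γ, hγ⟩ : Γ)) _ _ fun δ => rfl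
  · have hb0 : 0 ≤ b := (norm_nonneg _).trans (hb 1 Γ.one_mem)
    refine ContinuousLinearMap.opNorm_le_bound _ hb0 fun v => ?_
    rw [hαapp, norm_mul, norm_inv, Real.norm_of_nonneg hN.le, ← havg (b * ‖v‖)]
    refine mul_le_mul_of_nonneg_left ((norm_sum_le _ _).trans (Finset.sum_le_sum fun γ _ => ?_))
      (by positivity)
    have := ContinuousLinearMap.le_of_opNorm_le_of_le _ (hb γ.1 γ.2) (hG1 γ v)
    rwa [one_mul] at this
  · have hb0 : 0 ≤ b := (norm_nonneg (fderiv ℝ β _)).trans (hb 1 Γ.one_mem)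
    refine ContinuousLinearMap.opNorm_le_bound₂ _ hb0 fun u v => ?_
    rw [hαd, norm_mul, norm_inv, Real.norm_of_nonneg hN.le, ← havg (b * ‖u‖ * ‖v‖)]
    refine mul_le_mul_of_nonneg_left ((norm_sum_le _ _).trans (Finset.sum_le_sum fun γ _ => ?_))
      (by positivity)
    have := ContinuousLinearMap.le_of_opNorm_le_of_le _
      (ContinuousLinearMap.le_of_opNorm_le_of_le _ (hb γ.1 γ.2) (hG1 γ u)) (hG1 γ v)
    rwa [one_mul, one_mul] at this
  · rw [hαd, hαd, ← mul_sub, ← Finset.sum_sub_distrib]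
    rw [Finset.sum_congr rfl fun γ _ => hb γ.1 γ.2, havg]

theorem exists_norm_le_of_isBigO {F : Type*} [NormedAddCommGroup F] {f : R4 → F} {a : ℝ}
    (h : f =O[Bornology.cobounded R4] fun x => ‖x‖ ^ a) :
    ∃ C r : ℝ, 0 ≤ C ∧ ∀ x, r ≤ ‖x‖ → ‖f x‖ ≤ C * ‖x‖ ^ a := by
  obtain ⟨C, hC, h1⟩ := h.exists_nonneg
  rw [isBigOWith_iff] at h1
  obtain ⟨r, -, hr⟩ := hasBasis_cobounded_norm.eventually_iff.1 h1
  refine ⟨C, r, hC, fun x hx => (hr hx).trans (le_of_eq ?_)⟩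
  rw [Real.norm_of_nonneg (by positivity)]

/-- A closed two-form `W` on the exterior of a ball that is asymptotic to `ω₀` is brought into the
form `ω₀` near infinity by a diffeomorphism of `ℝ⁴` that is asymptotic to the identity and
commutes with the symmetries of `W` and `ω₀`. The difference `W - ω₀` is cut off near the ball, a
primitive of it is averaged over the group, and Moser's isotopy applies. -/
theorem exists_darboux_at_infinity {W : R4 → R4 →L[ℝ] R4 →L[ℝ] ℝ} {R : ℝ} (hR : 0 < R)
    (hW : ContDiffOn ℝ 2 W (exterior R)) (halt : ∀ x v, W x v v = 0)
    (hcl : ∀ x ∈ exterior R, IsClosedFormAt W x) (Γ : Subgroup (R4 ≃ₗᵢ[ℝ] R4)) [Finite Γ]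
    (hΓ0 : ∀ γ ∈ Γ, ∀ u v, stdBilin (γ u) (γ v) = stdBilin u v)
    (hΓW : ∀ γ ∈ Γ, ∀ x ∈ exterior R, ∀ u v, W (γ x) (γ u) (γ v) = W x u v)
    {ε : ℝ} (hε : 0 < ε)
    (h0 : (fun x => W x - stdBilin) =O[Bornology.cobounded R4] fun x => ‖x‖ ^ (-1 - ε))
    (h1 : (fun x => fderiv ℝ W x) =O[Bornology.cobounded R4] fun x => ‖x‖ ^ (-2 - ε)) :
    ∃ (Ψ : R4 ≃ₜ R4) (c C : ℝ), ContDiff ℝ 2 Ψ ∧ ContDiff ℝ 2 Ψ.symm ∧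
      (∀ x, ‖Ψ x - x‖ ≤ 1) ∧ (∀ γ ∈ Γ, ∀ x, Ψ (γ x) = γ (Ψ x)) ∧
      (∀ x, c < ‖x‖ → ∀ u v, W (Ψ x) (fderiv ℝ Ψ x u) (fderiv ℝ Ψ x v) = stdBilin u v) ∧
      (∀ x, c < ‖x‖ → ‖Ψ x - x‖ ≤ C * ‖x‖ ^ (-ε)) ∧
      (∀ x, c < ‖x‖ → ‖fderiv ℝ Ψ x - ContinuousLinearMap.id ℝ R4‖ ≤ C * ‖x‖ ^ (-1 - ε)) := by
  obtain ⟨C₀, r₀, hC₀, hr₀⟩ := exists_norm_le_of_isBigO h0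
  obtain ⟨C₁, r₁, hC₁, hr₁⟩ := exists_norm_le_of_isBigO h1
  obtain ⟨r, hr1, hrR, hrr₀, hrr₁, hrC⟩ : ∃ r : ℝ, 1 ≤ r ∧ R + 1 ≤ r ∧ r₀ ≤ r ∧ r₁ ≤ r ∧
      C₀ * r ^ (-(1 + ε)) ≤ 1 / 4 := by
    have h2 : Tendsto (fun r : ℝ => C₀ * r ^ (-(1 + ε))) atTop (𝓝 (C₀ * 0)) :=
      (tendsto_rpow_neg_atTop (by linarith)).const_mul _
    rw [mul_zero] at h2
    exact ((eventually_ge_atTop 1).and ((eventually_ge_atTop (R + 1)).and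
      ((eventually_ge_atTop r₀).and ((eventually_ge_atTop r₁).and
        (h2.eventually_le_const (by norm_num : (0 : ℝ) < 1 / 4)))))).exists
  have hr : 0 < r := by linarith
  have hopen : IsOpen (exterior R) := Metric.isClosed_closedBall.isOpen_compl
  have hmem : ∀ x, x ∈ exterior R ↔ R < ‖x‖ := fun x => by simp [exterior]
  -- `η` is closed only outside the ball of radius `2 r`, where the cut-off function is `1`
  let η : R4 → R4 →L[ℝ] R4 →L[ℝ] ℝ := fun x => cutoff r x • (W x - stdBilin)
  have hη0 : ∀ x, ‖x‖ ≤ r → η x = 0 := fun x hx => by simp [η, cutoff_eq_zero hr hx]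
  have hη1 : ∀ x, 2 * r ≤ ‖x‖ → η x = W x - stdBilin := fun x hx => by
    simp [η, cutoff_eq_one hr hx]
  have hηC : ContDiff ℝ 2 η := by
    rw [contDiff_iff_contDiffAt]
    intro x
    rcases lt_or_ge R ‖x‖ with hx | hx
    · exact (contDiff_cutoff (n := 2) r).contDiffAt.smul
        ((hW.contDiffAt (hopen.mem_nhds ((hmem x).2 hx))).sub contDiffAt_const)
    · have hloc : η =ᶠ[𝓝 x] fun _ => 0 := by
        filter_upwards [(isOpen_lt continuous_norm continuous_const).mem_nhds
          (show ‖x‖ < r by linarith)] with y hy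
        exact hη0 y (le_of_lt hy)
      exact contDiffAt_const.congr_of_eventuallyEq hloc
  have hηb : ∀ x, r ≤ ‖x‖ → ‖η x‖ ≤ C₀ * ‖x‖ ^ (-(1 + ε)) := fun x hx => by
    have h2 := hr₀ x (hrr₀.trans hx)
    rw [← neg_add'] at h2
    refine le_trans ?_ h2
    simp only [η]
    rw [norm_smul, Real.norm_of_nonneg (cutoff_nonneg _ _)]
    exact mul_le_of_le_one_left (norm_nonneg (W x - stdBilin)) (cutoff_le_one _ _)
  have hsmall : ∀ x, ‖η x‖ ≤ 1 / 4 := fun x => by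
    rcases le_total r ‖x‖ with hx | hx
    · refine (hηb x hx).trans (le_trans (mul_le_mul_of_nonneg_left ?_ hC₀) hrC)
      exact Real.rpow_le_rpow_of_nonpos hr hx (by linarith)
    · rw [hη0 x hx, norm_zero]; norm_num
  have hηalt : ∀ x v, η x v v = 0 := fun x v => by
    simp [η, halt, stdBilin_self]
  have hηfd : ∀ x, 2 * r < ‖x‖ → fderiv ℝ η x = fderiv ℝ W x := fun x hx => by
    have hloc : η =ᶠ[𝓝 x] fun y => W y - stdBilin := by
      filter_upwards [(isOpen_lt continuous_const continuous_norm).mem_nhds hx] with y hy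
      exact hη1 y (le_of_lt hy)
    rw [hloc.fderiv_eq, fderiv_sub_const]
  have hηcl : ∀ x, 3 * r ≤ ‖x‖ → IsClosedFormAt η x := fun x hx => by
    have h2 := hcl x ((hmem x).2 (by linarith))
    unfold IsClosedFormAt at h2 ⊢
    rwa [hηfd x (by linarith)]
  have hηd : ∀ x, 3 * r ≤ ‖x‖ → ‖fderiv ℝ η x‖ ≤ C₁ * ‖x‖ ^ (-(2 + ε)) := fun x hx => by
    rw [hηfd x (by linarith), neg_add']
    exact hr₁ x (by linarith)
  have hηΓ : ∀ γ ∈ Γ, ∀ x u v, η (γ x) (γ u) (γ v) = η x u v := fun γ hγ x u v => by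
    rcases lt_or_ge R ‖x‖ with hx | hx
    · simp only [η, cutoff_isometry, smul_apply, sub_apply, hΓ0 γ hγ,
        hΓW γ hγ x ((hmem x).2 hx)]
    · rw [hη0 x (by linarith), hη0 (γ x) (by rw [LinearIsometryEquiv.norm_map]; linarith)]
      rfl
  obtain ⟨β, hβC, hβd, hβ0, hβ1⟩ := exists_primitive hηC hηalt hηcl
  obtain ⟨α, hαC, hαΓ, hα0, hα1, hαd⟩ := exists_invariant_average Γ hβC
  -- the bounds for `η` at the points `y` with `‖y‖ ≥ ‖x‖ / 4`
  have hB : ∀ x : R4, 12 * r ≤ ‖x‖ → ∀ y : R4, 1 / 4 * ‖x‖ ≤ ‖y‖ →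
      ‖η y‖ ≤ C₀ * (4 ^ (1 + ε) * ‖x‖ ^ (-(1 + ε))) := fun x hx y hy =>
    (hηb y (by linarith)).trans (mul_le_mul_of_nonneg_left
      (rpow_neg_le_of_quarter_le (by linarith) (by linarith) hy) hC₀)
  have hB' : ∀ x : R4, 12 * r ≤ ‖x‖ → ∀ y : R4, 1 / 4 * ‖x‖ ≤ ‖y‖ →
      ‖fderiv ℝ η y‖ ≤ C₁ * (4 ^ (2 + ε) * ‖x‖ ^ (-(2 + ε))) := fun x hx y hy =>
    (hηd y (by linarith)).trans (mul_le_mul_of_nonneg_left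
      (rpow_neg_le_of_quarter_le (by linarith) (by linarith) hy) hC₁)
  have hpow1 : ∀ x : R4, 12 * r ≤ ‖x‖ → ‖x‖ * ‖x‖ ^ (-(1 + ε)) = ‖x‖ ^ (-ε) := fun x hx => by
    have hx0 : 0 < ‖x‖ := by linarith
    rw [← Real.rpow_one_add' hx0.le (by linarith)]
    congr 1; ring
  have hpow2 : ∀ x : R4, 12 * r ≤ ‖x‖ → ‖x‖ * ‖x‖ ^ (-(2 + ε)) = ‖x‖ ^ (-1 - ε) := fun x hx => by
    have hx0 : 0 < ‖x‖ := by linarith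
    rw [← Real.rpow_one_add' hx0.le (by linarith)]
    congr 1; ring
  let k₀ : ℝ := 36 * (C₀ * 4 ^ (1 + ε))
  let k₁ : ℝ := 216 * (C₁ * 4 ^ (2 + ε)) + 36 * (C₀ * 4 ^ (1 + ε))
  have hk₀ : 0 ≤ k₀ := by positivity
  have hk₁ : 0 ≤ k₁ := by positivity
  have hαb0 : ∀ x : R4, 12 * r ≤ ‖x‖ → ‖α x‖ ≤ k₀ * ‖x‖ ^ (-ε) := fun x hx =>
    hα0 x _ fun γ hγ => by
      have h2 := hβ0 (γ x) (C₀ * (4 ^ (1 + ε) * ‖x‖ ^ (-(1 + ε)))) (by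
        rw [LinearIsometryEquiv.norm_map]; exact hB x hx)
      rw [LinearIsometryEquiv.norm_map] at h2
      refine h2.trans (le_of_eq ?_)
      rw [← hpow1 x hx]
      simp only [k₀]; ring
  have hαb1 : ∀ x : R4, 12 * r ≤ ‖x‖ → ‖fderiv ℝ α x‖ ≤ k₁ * ‖x‖ ^ (-1 - ε) := fun x hx =>
    hα1 x _ fun γ hγ => by
      have h2 := hβ1 (γ x) (C₀ * (4 ^ (1 + ε) * ‖x‖ ^ (-(1 + ε))))
        (C₁ * (4 ^ (2 + ε) * ‖x‖ ^ (-(2 + ε))))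
        (by rw [LinearIsometryEquiv.norm_map]; exact hB x hx)
        (by rw [LinearIsometryEquiv.norm_map]; exact hB' x hx)
      rw [LinearIsometryEquiv.norm_map] at h2
      refine h2.trans (le_of_eq ?_)
      rw [neg_add' 1 ε, ← hpow2 x hx]
      simp only [k₁]; ring
  have hηα : ∀ x : R4, 12 * r ≤ ‖x‖ → ‖fderiv ℝ η x‖ * ‖α x‖ ≤ C₁ * k₀ * ‖x‖ ^ (-1 - ε) :=
    fun x hx => by
      have hx1 : 1 ≤ ‖x‖ := by linarith
      have h2 : ‖x‖ ^ (-(2 + ε)) ≤ ‖x‖ ^ (-1 - ε) :=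
        Real.rpow_le_rpow_of_exponent_le hx1 (by linarith)
      have h3 : ‖x‖ ^ (-ε) ≤ 1 := Real.rpow_le_one_of_one_le_of_nonpos hx1 (by linarith)
      calc _ ≤ (C₁ * ‖x‖ ^ (-1 - ε)) * (k₀ * 1) := by
            refine mul_le_mul ((hηd x (by linarith)).trans (mul_le_mul_of_nonneg_left h2 hC₁))
              ((hαb0 x hx).trans (mul_le_mul_of_nonneg_left h3 hk₀)) (norm_nonneg _)
              (by positivity)
        _ = _ := by ring
  let k := k₀ + k₁ + C₁ * k₀
  have hk : 0 ≤ k := by positivity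
  have hle : k₀ ≤ k ∧ k₁ ≤ k ∧ C₁ * k₀ ≤ k := by
    have := mul_nonneg hC₁ hk₀
    simp only [k]
    refine ⟨?_, ?_, ?_⟩ <;> linarith
  obtain ⟨Ψ, c, C, hΨ, hΨs, hΨ1, hΨΓ, hΨW, hΨ0, hΨI⟩ := exists_moser_diffeo hηC hαC hsmall hηalt
    (r := 12 * r) hε hk
    (fun x hx => (hαb0 x hx).trans (mul_le_mul_of_nonneg_right hle.1 (by positivity)))
    (fun x hx => (hαb1 x hx).trans (mul_le_mul_of_nonneg_right hle.2.1 (by positivity)))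
    (fun x hx => (hηα x hx).trans (mul_le_mul_of_nonneg_right hle.2.2 (by positivity)))
    (fun x hx => hηcl x (by linarith))
    (fun x hx u v => hαd x u v _ fun γ hγ => by
      rw [hβd (γ x) (norm_pos_iff.1 (by rw [LinearIsometryEquiv.norm_map]; linarith))
        (by rw [LinearIsometryEquiv.norm_map]; linarith), hηΓ γ hγ])
  refine ⟨Ψ, max c (2 * r + 1), C, hΨ, hΨs, hΨ1,
    fun γ hγ => hΨΓ γ (hΓ0 γ hγ) (hηΓ γ hγ) (hαΓ γ hγ), fun x hx u v => ?_,
    fun x hx => hΨ0 x ((le_max_left _ _).trans_lt hx),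
    fun x hx => hΨI x ((le_max_left _ _).trans_lt hx)⟩
  have h2 : 2 * r ≤ ‖Ψ x‖ := by
    have h3 := norm_sub_norm_le x (Ψ x)
    rw [norm_sub_rev] at h3
    linarith [hΨ1 x, (le_max_right c (2 * r + 1)).trans_lt hx]
  have h3 := hΨW x ((le_max_left _ _).trans_lt hx) u v
  rwa [hη1 _ h2, add_sub_cancel] at h3

end Darboux

/-! ### From alternating forms to bilinear forms -/

section BilinearForm

set_option maxSynthPendingDepth 3

/-- The bilinear form `(u, v) ↦ η ![u, v]` of a `2`-form `η`, as a continuous linear function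
of `η`. -/
noncomputable def bilinOfForm : (R4 [⋀^Fin 2]→L[ℝ] ℝ) →L[ℝ] R4 →L[ℝ] R4 →L[ℝ] ℝ :=
  (ContinuousLinearMap.compL ℝ R4 (R4 [⋀^Fin 1]→L[ℝ] ℝ) (R4 →L[ℝ] ℝ)
    (ContinuousAlternatingMap.ofSubsingletonLIE (𝕜 := ℝ) (E := R4) (F := ℝ)
      (0 : Fin 1)).symm.toContinuousLinearEquiv.toContinuousLinearMap).comp
    (ContinuousAlternatingMap.curryLeftLI (𝕜 := ℝ) (E := R4) (F := ℝ)
      (n := 1)).toContinuousLinearMap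

theorem bilinOfForm_apply (η : R4 [⋀^Fin 2]→L[ℝ] ℝ) (u v : R4) :
    bilinOfForm η u v = η ![u, v] := by
  change η (Matrix.vecCons u fun _ => v) = _
  congr 1
  ext i : 1
  fin_cases i <;> rfl

theorem bilinOfForm_self (η : R4 [⋀^Fin 2]→L[ℝ] ℝ) (v : R4) : bilinOfForm η v v = 0 := by
  rw [bilinOfForm_apply]
  exact η.map_eq_zero_of_eq _ (i := 0) (j := 1) rfl (by decide)

theorem ext_of_bilinOfForm {η η' : R4 [⋀^Fin 2]→L[ℝ] ℝ}
    (h : ∀ u v, bilinOfForm η u v = bilinOfForm η' u v) : η = η' := by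
  ext v
  have h1 := h (v 0) (v 1)
  rw [bilinOfForm_apply, bilinOfForm_apply] at h1
  have h2 : v = ![v 0, v 1] := by ext i : 1; fin_cases i <;> rfl
  rwa [h2]

theorem bilinOfForm_stdForm : bilinOfForm stdForm = stdBilin := by
  ext u v
  rw [bilinOfForm_apply]
  rfl

theorem isClosedFormAt_bilinOfForm {η : R4 → R4 [⋀^Fin 2]→L[ℝ] ℝ} {x : R4}
    (hη : DifferentiableAt ℝ η x) (h : extDeriv η x = 0) :
    IsClosedFormAt (fun y => bilinOfForm (η y)) x := by
  intro a b c
  have h1 := extDeriv_apply hη ![a, b, c]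
  have h2 : ∀ u v w, fderiv ℝ (fun y => η y ![v, w]) x u =
      fderiv ℝ (fun y => bilinOfForm (η y)) x u v w := fun u v w => by
    have h3 := (bilinOfForm.hasFDerivAt.comp x hη.hasFDerivAt).fderiv
    have h4 : HasFDerivAt (fun y => η y ![v, w])
        ((ContinuousAlternatingMap.apply ℝ R4 ℝ ![v, w]).comp (fderiv ℝ η x)) x :=
      (ContinuousAlternatingMap.apply ℝ R4 ℝ ![v, w]).hasFDerivAt.comp x hη.hasFDerivAt
    change fderiv ℝ (fun y => bilinOfForm (η y)) x = _ at h3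
    rw [h3, h4.fderiv]
    change (fderiv ℝ η x u) ![v, w] = bilinOfForm (fderiv ℝ η x u) v w
    rw [bilinOfForm_apply]
  have r0 : (0 : Fin 3).removeNth ![a, b, c] = ![b, c] := by
    ext i : 1; fin_cases i <;> rfl
  have r1 : (1 : Fin 3).removeNth ![a, b, c] = ![a, c] := by
    ext i : 1; fin_cases i <;> rfl
  have r2 : (2 : Fin 3).removeNth ![a, b, c] = ![a, b] := by
    ext i : 1; fin_cases i <;> rfl
  rw [h, Fin.sum_univ_three, r0, r1, r2, h2, h2, h2] at h1
  simp at h1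
  linarith

theorem mem_exterior {R : ℝ} {y : R4} : y ∈ exterior R ↔ R < ‖y‖ := by
  simp [exterior]

theorem isOpen_exterior (R : ℝ) : IsOpen (exterior R) := Metric.isClosed_closedBall.isOpen_compl

theorem stdBilin_map_of_mem_unitaryTwo {γ : R4 ≃ₗᵢ[ℝ] R4} (hγ : γ ∈ unitaryTwo) (u v : R4) :
    stdBilin (γ u) (γ v) = stdBilin u v := by
  have h : ∀ w, γ (stdJ w) = stdJ (γ w) := hγ
  change inner ℝ (stdJ (γ u)) (γ v) = inner ℝ (stdJ u) v
  rw [← h, γ.inner_map_map]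

/-- `exists_darboux_at_infinity`, for alternating forms. -/
theorem exists_darboux_twoForm {η : R4 → R4 [⋀^Fin 2]→L[ℝ] ℝ} {R : ℝ} (hR : 0 < R)
    (hη : ContDiffOn ℝ 2 η (exterior R)) (hcl : ∀ y ∈ exterior R, extDeriv η y = 0)
    (Γ : Subgroup (R4 ≃ₗᵢ[ℝ] R4)) [Finite Γ] (hΓ : Γ ≤ unitaryTwo)
    (hΓη : ∀ γ ∈ Γ, ∀ y ∈ exterior R, ∀ u v,
      bilinOfForm (η (γ y)) (γ u) (γ v) = bilinOfForm (η y) u v) {ε : ℝ} (hε : 0 < ε)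
    (h0 : (fun y => η y - stdForm) =O[Bornology.cobounded R4] fun y => ‖y‖ ^ (-1 - ε))
    (h1 : (fun y => fderiv ℝ η y) =O[Bornology.cobounded R4] fun y => ‖y‖ ^ (-2 - ε)) :
    ∃ (Ψ : R4 ≃ₜ R4) (c C : ℝ), ContDiff ℝ 2 Ψ ∧ ContDiff ℝ 2 Ψ.symm ∧
      (∀ y, ‖Ψ y - y‖ ≤ 1) ∧ (∀ γ ∈ Γ, ∀ y, Ψ (γ y) = γ (Ψ y)) ∧
      (∀ y, c < ‖y‖ → (η (Ψ y)).compContinuousLinearMap (fderiv ℝ Ψ y) = stdForm) ∧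
      (∀ y, c < ‖y‖ → ‖Ψ y - y‖ ≤ C * ‖y‖ ^ (-ε)) ∧
      (∀ y, c < ‖y‖ → ‖fderiv ℝ Ψ y - ContinuousLinearMap.id ℝ R4‖ ≤ C * ‖y‖ ^ (-1 - ε)) := by
  have hd : ∀ y ∈ exterior R, DifferentiableAt ℝ η y := fun y hy =>
    (hη.contDiffAt ((isOpen_exterior R).mem_nhds hy)).differentiableAt two_ne_zero
  have hfd : ∀ y ∈ exterior R, fderiv ℝ (fun z => bilinOfForm (η z)) y =
      bilinOfForm.comp (fderiv ℝ η y) := fun y hy =>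
    (bilinOfForm.hasFDerivAt.comp y (hd y hy).hasFDerivAt).fderiv
  have hB := bilinOfForm_stdForm
  obtain ⟨Ψ, c, C, hΨ, hΨs, hΨ1, hΨΓ, hΨW, hΨ0, hΨI⟩ := exists_darboux_at_infinity
    (W := fun y => bilinOfForm (η y)) hR
    (bilinOfForm.contDiff.comp_contDiffOn hη) (fun _ _ => bilinOfForm_self _ _)
    (fun y hy => isClosedFormAt_bilinOfForm (hd y hy) (hcl y hy)) Γ
    (fun γ hγ => stdBilin_map_of_mem_unitaryTwo (hΓ hγ)) hΓη hε
    (by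
      rw [← hB]
      simp only [← map_sub]
      exact (bilinOfForm.isBigO_comp _ _).trans h0)
    (by
      have h2 : (fun y => bilinOfForm.comp (fderiv ℝ η y))
          =O[Bornology.cobounded R4] fun y => ‖y‖ ^ (-2 - ε) :=
        (IsBigO.of_bound ‖bilinOfForm‖ (Eventually.of_forall fun y =>
          bilinOfForm.opNorm_comp_le _)).trans h1
      refine h2.congr' ?_ EventuallyEq.rfl
      filter_upwards [tendsto_norm_cobounded_atTop.eventually (eventually_gt_atTop R)] with y hy
        using (hfd y (mem_exterior.2 hy)).symm)
  refine ⟨Ψ, c, C, hΨ, hΨs, hΨ1, hΨΓ, fun y hy => ext_of_bilinOfForm fun u v => ?_, hΨ0, hΨI⟩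
  rw [hB, ← hΨW y hy u v, bilinOfForm_apply, bilinOfForm_apply]
  change η (Ψ y) (fun i => fderiv ℝ Ψ y (![u, v] i)) = _
  congr 1
  ext i : 1
  fin_cases i <;> rfl

end BilinearForm

/-! ### The Kähler form in asymptotic coordinates -/

section Coordinates

set_option maxSynthPendingDepth 3

theorem map_mem_exterior {R : ℝ} {y : R4} (hy : y ∈ exterior R) (γ : R4 ≃ₗᵢ[ℝ] R4) :
    γ y ∈ exterior R := by
  rw [mem_exterior] at *
  rwa [γ.norm_map]

variable {M' : Type*} [TopologicalSpace M'] [ChartedSpace R4 M']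

theorem IsAsymptoticCoordinates.comp_symm_map {M : Type*} {p : M' → M} {R : ℝ}
    {Γ : Subgroup (R4 ≃ₗᵢ[ℝ] R4)} {x : OpenPartialHomeomorph M' R4}
    (hx : IsAsymptoticCoordinates p R Γ x) {γ : R4 ≃ₗᵢ[ℝ] R4} (hγ : γ ∈ Γ) {y : R4}
    (hy : y ∈ exterior R) : p (x.symm (γ y)) = p (x.symm y) := by
  obtain ⟨τ, hτp, hτx⟩ := hx.deck_surj γ hγ
  have h1 : x.symm (γ y) = τ (x.symm y) := by
    rw [← x.right_inv (x := y) (by rwa [hx.target_eq]), ← hτx, x.left_inv (by simp [hx.source_eq]),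
      x.right_inv (by rwa [hx.target_eq])]
  rw [h1, hτp]

variable {M : Type*} [TopologicalSpace M] [ChartedSpace R4 M]

/-- A covering of an end, read in asymptotic coordinates, is a local diffeomorphism. -/
theorem IsAsymptoticCoordinates.isLocalDiffeomorphAt {p : M' → M} {R : ℝ}
    {Γ : Subgroup (R4 ≃ₗᵢ[ℝ] R4)} {x : OpenPartialHomeomorph M' R4}
    (hx : IsAsymptoticCoordinates p R Γ x)
    (hp : IsLocalDiffeomorph 𝓘(ℝ, R4) 𝓘(ℝ, R4) ∞ p) {y : R4} (hy : y ∈ exterior R) :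
    IsLocalDiffeomorphAt 𝓘(ℝ, R4) 𝓘(ℝ, R4) ∞ (p ∘ x.symm) y := by
  let X : PartialDiffeomorph 𝓘(ℝ, R4) 𝓘(ℝ, R4) R4 M' ∞ :=
    { x.symm.toPartialEquiv with
      open_source := x.open_target
      open_target := x.open_source
      contMDiffOn_toFun := by
        change ContMDiffOn _ _ _ x.symm x.target
        rw [hx.target_eq]
        exact hx.contMDiffOn_symm
      contMDiffOn_invFun := hx.contMDiff.contMDiffOn }
  have h1 : IsLocalDiffeomorphAt 𝓘(ℝ, R4) 𝓘(ℝ, R4) ∞ x.symm y :=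
    ⟨X, by change y ∈ x.target; rwa [hx.target_eq], fun _ _ => rfl⟩
  exact IsLocalDiffeomorphAt.comp 𝓘(ℝ, R4) M h1 (hp _)

variable [IsManifold 𝓘(ℝ, R4) ∞ M]

/-- `dω = 0` in asymptotic coordinates: there `p ∘ x⁻¹` is locally the inverse of a chart of the
maximal atlas. -/
theorem KahlerSurface.extDeriv_coordForm (S : KahlerSurface M) {p : M' → M} {R : ℝ}
    {Γ : Subgroup (R4 ≃ₗᵢ[ℝ] R4)} {x : OpenPartialHomeomorph M' R4}
    (hx : IsAsymptoticCoordinates p R Γ x)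
    (hp : IsLocalDiffeomorph 𝓘(ℝ, R4) 𝓘(ℝ, R4) ∞ p) {y : R4} (hy : y ∈ exterior R) :
    extDeriv (S.coordForm p x) y = 0 := by
  obtain ⟨Φ, hyΦ, hΦ⟩ := hx.isLocalDiffeomorphAt hp hy
  have hatlas : Φ.toOpenPartialHomeomorph.symm ∈ IsManifold.maximalAtlas 𝓘(ℝ, R4) ∞ M :=
    (IsManifold.mem_maximalAtlas_iff_contMDiffOn _).2
      ⟨Φ.contMDiffOn_invFun, Φ.contMDiffOn_toFun⟩
  have h1 := S.closed _ hatlas y hyΦ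
  refine Eq.trans (Filter.EventuallyEq.extDeriv_eq ?_) h1
  filter_upwards [Φ.open_source.mem_nhds hyΦ] with z hz
  have h2 : p ∘ x.symm =ᶠ[𝓝 z] Φ := by
    filter_upwards [Φ.open_source.mem_nhds hz] with w hw using hΦ hw
  change pullbackForm _ _ _ = pullbackForm _ Φ z
  unfold pullbackForm
  rw [h2.mfderiv_eq]
  have h3 := hΦ hz
  generalize mfderiv 𝓘(ℝ, R4) 𝓘(ℝ, R4) Φ z = A
  change (S.kahlerForm ((p ∘ x.symm) z)).compContinuousLinearMap A =
    (S.kahlerForm (Φ z)).compContinuousLinearMap A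
  rw [h3]

theorem KahlerSurface.coordForm_map (S : KahlerSurface M) {p : M' → M} {R : ℝ}
    {Γ : Subgroup (R4 ≃ₗᵢ[ℝ] R4)} {x : OpenPartialHomeomorph M' R4}
    (hx : IsAsymptoticCoordinates p R Γ x)
    (hp : IsLocalDiffeomorph 𝓘(ℝ, R4) 𝓘(ℝ, R4) ∞ p) {γ : R4 ≃ₗᵢ[ℝ] R4} (hγ : γ ∈ Γ) {y : R4}
    (hy : y ∈ exterior R) (u v : R4) :
    bilinOfForm (S.coordForm p x (γ y)) (γ u) (γ v) = bilinOfForm (S.coordForm p x y) u v := by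
  let G : R4 →L[ℝ] R4 := γ.toContinuousLinearEquiv.toContinuousLinearMap
  have hq : MDifferentiableAt 𝓘(ℝ, R4) 𝓘(ℝ, R4) (p ∘ x.symm) (G y) :=
    (hx.isLocalDiffeomorphAt hp (map_mem_exterior hy γ)).mdifferentiableAt (by simp)
  have h1 : (p ∘ x.symm) ∘ G =ᶠ[𝓝 y] p ∘ x.symm := by
    filter_upwards [(isOpen_exterior R).mem_nhds hy] with z hz using hx.comp_symm_map hγ hz
  have h2 := mfderiv_comp y hq G.differentiableAt.mdifferentiableAt
  rw [h1.mfderiv_eq, mfderiv_eq_fderiv, G.fderiv] at h2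
  have h3 : (p ∘ x.symm) (γ y) = (p ∘ x.symm) y := h1.self_of_nhds
  have h4 : ∀ w, mfderiv 𝓘(ℝ, R4) 𝓘(ℝ, R4) (p ∘ x.symm) y w =
      mfderiv 𝓘(ℝ, R4) 𝓘(ℝ, R4) (p ∘ x.symm) (γ y) (γ w) := fun w => DFunLike.congr_fun h2 w
  have h5 : ∀ (m m' : M), m = m' → ∀ a b a' b' : R4, a = a' → b = b' →
      S.kahlerForm m ![a, b] = S.kahlerForm m' ![a', b'] := by
    rintro m _ rfl a b _ _ rfl rfl
    rfl
  rw [bilinOfForm_apply, bilinOfForm_apply]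
  exact h5 _ _ h3 _ _ _ _ (h4 u).symm (h4 v).symm

end Coordinates

/-! ### The theorem of Darboux at infinity for Kähler ends -/

theorem isC2Ball_image_closedBall {Ψ : R4 ≃ₜ R4} (hΨ : ContDiff ℝ 2 Ψ)
    (hΨs : ContDiff ℝ 2 Ψ.symm) {c : ℝ} (hc : 0 < c) :
    IsC2Ball (Ψ '' Metric.closedBall 0 c) := by
  let Θ : R4 ≃ₘ^2⟮𝓘(ℝ, R4), 𝓘(ℝ, R4)⟯ R4 :=
    { toEquiv := (Homeomorph.smulOfNeZero c hc.ne').toEquiv.trans Ψ.toEquiv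
      contMDiff_toFun := (hΨ.comp (contDiff_id.const_smul c)).contMDiff
      contMDiff_invFun := ((contDiff_id.const_smul c⁻¹).comp hΨs).contMDiff }
  have hΘ : ∀ s : Set R4, Θ '' s = Ψ '' ((fun y => c • y) '' s) := fun s => by
    rw [image_image]
    rfl
  have h1 : (fun y : R4 => c • y) '' Metric.closedBall 0 1 = Metric.closedBall 0 c := by
    have := smul_closedBall c (0 : R4) zero_le_one
    rwa [smul_zero, mul_one, Real.norm_of_nonneg hc.le] at this
  have h2 : (fun y : R4 => c • y) '' Metric.sphere 0 1 = Metric.sphere 0 c := by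
    have := smul_sphere c (0 : R4) zero_le_one
    rwa [smul_zero, mul_one, Real.norm_of_nonneg hc.le] at this
  refine ⟨Θ, by rw [hΘ, h1], ?_⟩
  rw [hΘ, h2, ← Ψ.image_frontier, frontier_closedBall _ hc.ne']

theorem mainTheorem5
    {M : Type*} [TopologicalSpace M] [T2Space M] [SecondCountableTopology M]
    [ChartedSpace R4 M] [IsManifold 𝓘(ℝ, R4) ∞ M]
    (S : KahlerSurface M) (K : Set M) (hALE : S.IsALE K)
    (U : Set M) (hU : U ∈ ends K)
    {M' : Type*} [TopologicalSpace M'] [ChartedSpace R4 M'] [IsManifold 𝓘(ℝ, R4) ∞ M']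
    (p : M' → M) (hp : IsUniversalCover p U)
    (R : ℝ) (hR : 0 < R)
    (Γ : Subgroup (R4 ≃ₗᵢ[ℝ] R4)) (hΓfin : Finite Γ) (hΓ : Γ ≤ unitaryTwo)
    (x : OpenPartialHomeomorph M' R4) (hx : IsAsymptoticCoordinates p R Γ x)
    (hωC2 : ContDiffOn ℝ 2 (S.coordForm p x) (exterior R))
    (ε : ℝ) (hε : 0 < ε)
    (hω : (fun y => S.coordForm p x y - stdForm) =O[Bornology.cobounded R4]
      (fun y => ‖y‖ ^ (-1 - ε)))
    (hdω : (fun y => fderiv ℝ (S.coordForm p x) y) =O[Bornology.cobounded R4]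
      (fun y => ‖y‖ ^ (-2 - ε))) :
    ∃ (c : ℝ) (D : Set R4) (Φ : OpenPartialHomeomorph R4 R4),
      Metric.closedBall 0 R ⊆ Metric.closedBall 0 c ∩ D ∧
      IsC2Ball D ∧
      (∀ γ ∈ Γ, γ '' frontier D = frontier D) ∧
      Φ.source = exterior c ∧ Φ.target = Dᶜ ∧
      ContDiffOn ℝ 2 Φ (exterior c) ∧ ContDiffOn ℝ 2 Φ.symm Dᶜ ∧
      (∀ γ ∈ Γ, ∀ y ∈ exterior c, Φ (γ y) = γ (Φ y)) ∧
      (∀ y ∈ exterior c,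
        (S.coordForm p x (Φ y)).compContinuousLinearMap (fderiv ℝ Φ y) = stdForm) ∧
      (fun y => Φ y - y) =O[Bornology.cobounded R4] (fun y => ‖y‖ ^ (-ε)) ∧
      (fun y => fderiv ℝ Φ y - ContinuousLinearMap.id ℝ R4) =O[Bornology.cobounded R4]
        (fun y => ‖y‖ ^ (-1 - ε)) := by
  have hlocal := hp.localDiffeo
  obtain ⟨Ψ, c, C, hΨ, hΨs, hΨ1, hΨΓ, hΨW, hΨ0, hΨI⟩ := exists_darboux_twoForm hR hωC2
    (fun y hy => S.extDeriv_coordForm hx hlocal hy) Γ hΓ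
    (fun γ hγ y hy => S.coordForm_map hx hlocal hγ hy) hε hω hdω
  have hfar : ∀ᶠ y in Bornology.cobounded R4, c < ‖y‖ :=
    tendsto_norm_cobounded_atTop.eventually (eventually_gt_atTop c)
  -- since `Ψ` moves points by at most `1`, the image of the ball of radius `R + 1` contains the
  -- ball of radius `R`
  let c' := max c (R + 1)
  have hcc : c ≤ c' := le_max_left _ _
  have hRc : R + 1 ≤ c' := le_max_right _ _
  have himage : Ψ '' exterior c' = (Ψ '' Metric.closedBall 0 c')ᶜ :=
    image_compl_eq Ψ.bijective
  let Φ : OpenPartialHomeomorph R4 R4 :=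
    (Ψ.toOpenPartialHomeomorph.restrOpen (exterior c') (isOpen_exterior c'))
  have hmap : ∀ (γ : R4 ≃ₗᵢ[ℝ] R4), γ ∈ Γ → γ '' frontier (Ψ '' Metric.closedBall 0 c') =
      frontier (Ψ '' Metric.closedBall 0 c') := fun γ hγ => by
    rw [← Ψ.image_frontier, frontier_closedBall _ (by linarith : c' ≠ 0), image_image]
    simp only [← hΨΓ γ hγ]
    rw [← image_image Ψ γ, γ.image_sphere, map_zero]
  refine ⟨c', Ψ '' Metric.closedBall 0 c', Φ, ?_, isC2Ball_image_closedBall hΨ hΨs (by linarith),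
    hmap, ?_, ?_, hΨ.contDiffOn, hΨs.contDiffOn, fun γ hγ y _ => hΨΓ γ hγ y,
    fun y hy => hΨW y (hcc.trans_lt (mem_exterior.1 hy)), ?_, ?_⟩
  · refine subset_inter (Metric.closedBall_subset_closedBall (by linarith)) fun y hy => ?_
    refine ⟨Ψ.symm y, ?_, Ψ.apply_symm_apply y⟩
    have h1 := hΨ1 (Ψ.symm y)
    rw [Ψ.apply_symm_apply, norm_sub_rev] at h1
    have h2 := norm_sub_norm_le (Ψ.symm y) y
    rw [mem_closedBall_zero_iff] at hy ⊢
    linarith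
  · exact univ_inter _
  · rw [← himage]
    change univ ∩ Ψ.symm ⁻¹' exterior c' = _
    rw [univ_inter, Ψ.image_eq_preimage_symm]
  · refine IsBigO.of_bound C ?_
    filter_upwards [hfar] with y hy
    rw [Real.norm_of_nonneg (by positivity)]
    exact hΨ0 y hy
  · refine IsBigO.of_bound C ?_
    filter_upwards [hfar] with y hy
    rw [Real.norm_of_nonneg (by positivity)]
    exact hΨI y hy
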